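/- For a finite simple undirected graph $G$, let $\nu(G)$ be the maximum size of a matching of $G$, let $\beta(G)$ be the minimum size of an (inclusion-wise) maximal matching of $G$, and let $\mu(G)=\nu(G)-\beta(G)$ be the matching gap of $G$. MatchingGap is the decision problem whose input is a finite graph $G$ together with an integer $k\ge 0$, and whose question is whether $\mu(G)\ge k$. Theorem. There is an XP algorithm for MatchingGap when parameterized by $|V(G)|/2-\beta(G)$. That is, there is a single deterministic algorithm (a program of a random access machine with unit-cost addition, subtraction, comparison and indirect addressing, without multiplication; $G$ is given by its adjacency matrix, and the value of the parameter is not given) that decides for every input $(G,k)$ whether $\mu(G)\ge k$, and such that for every fixed value $c$ there is a polynomial $f_c$ for which the algorithm makes at most $f_c(|V(G)|)$ steps on every input $(G,k)$ with $|V(G)|/2-\beta(G)=c$. -/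

import Mathlib

namespace MatchingGapXP

/-! ### Matchings, the matching number, minimum maximal matchings, the matching gap -/

section Graphs

variable {V : Type*}

/-- The number of edges of a matching. A matching is a subgraph in which every vertex has exactly
one neighbour, so it is determined by its set of edges. -/
noncomputable def size {G : SimpleGraph V} (M : G.Subgraph) : ℕ := M.edgeSet.ncard

/-- A maximal matching: a matching that is contained in no larger matching. -/
def IsMaximalMatching {G : SimpleGraph V} (M : G.Subgraph) : Prop :=
  Maximal (fun M' : G.Subgraph => M'.IsMatching) M

/-- The matching number `ν(G)`: the maximum size of a matching of the (finite) graph `G`. -/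
noncomputable def matchingNumber (G : SimpleGraph V) : ℕ :=
  sSup {m : ℕ | ∃ M : G.Subgraph, M.IsMatching ∧ size M = m}

/-- The number `β(G)`: the minimum size of a maximal matching of the (finite) graph `G`. -/
noncomputable def mmmNumber (G : SimpleGraph V) : ℕ :=
  sInf {m : ℕ | ∃ M : G.Subgraph, IsMaximalMatching M ∧ size M = m}

/-- The matching gap `μ(G) = ν(G) - β(G)`; for a finite graph `β(G) ≤ ν(G)`, so the subtraction
does not truncate. -/
noncomputable def matchingGap (G : SimpleGraph V) : ℕ := matchingNumber G - mmmNumber G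

end Graphs

/-! ### Random access machines

Programs act on natural-number registers and on a memory of natural numbers that is addressed
indirectly. The arithmetic operations are addition and truncated subtraction only (no
multiplication), and every instruction and every test costs one step. This is the unit-cost RAM,
which is polynomially equivalent to the Turing machine. -/

/-- The contents of the registers and of the memory. -/
structure State where
  reg : ℕ → ℕ
  mem : ℕ → ℕ

/-- Write the value `v` to register `r`. -/
def State.setReg (s : State) (r v : ℕ) : State := { s with reg := Function.update s.reg r v }

/-- Write the value `v` to memory cell `a`. -/
def State.setMem (s : State) (a v : ℕ) : State := { s with mem := Function.update s.mem a v }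

/-- Programs. The arguments of the instructions are names of registers, except for the constant
`c` in `const`. -/
inductive Prog where
  /-- do nothing -/
  | skip : Prog
  /-- `reg r := c` -/
  | const (r c : ℕ) : Prog
  /-- `reg r := reg a` -/
  | copy (r a : ℕ) : Prog
  /-- `reg r := reg a + reg b` -/
  | add (r a b : ℕ) : Prog
  /-- `reg r := reg a - reg b` (truncated at zero) -/
  | sub (r a b : ℕ) : Prog
  /-- `reg r := mem (reg a)` -/
  | load (r a : ℕ) : Prog
  /-- `mem (reg a) := reg b` -/
  | store (a b : ℕ) : Prog
  /-- first `p`, then `q` -/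
  | seq (p q : Prog) : Prog
  /-- if `reg a < reg b` then `p` else `q` -/
  | cond (a b : ℕ) (p q : Prog) : Prog
  /-- as long as `reg a < reg b`, do `p` -/
  | loop (a b : ℕ) (p : Prog) : Prog

/-- `Run p s s' t`: started in the state `s`, the program `p` halts in the state `s'` after
exactly `t` steps. -/
inductive Run : Prog → State → State → ℕ → Prop
  | skip (s : State) : Run .skip s s 1
  | const (r c : ℕ) (s : State) : Run (.const r c) s (s.setReg r c) 1
  | copy (r a : ℕ) (s : State) : Run (.copy r a) s (s.setReg r (s.reg a)) 1
  | add (r a b : ℕ) (s : State) : Run (.add r a b) s (s.setReg r (s.reg a + s.reg b)) 1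
  | sub (r a b : ℕ) (s : State) : Run (.sub r a b) s (s.setReg r (s.reg a - s.reg b)) 1
  | load (r a : ℕ) (s : State) : Run (.load r a) s (s.setReg r (s.mem (s.reg a))) 1
  | store (a b : ℕ) (s : State) : Run (.store a b) s (s.setMem (s.reg a) (s.reg b)) 1
  | seq {p q : Prog} {s s' s'' : State} {t t' : ℕ} :
      Run p s s' t → Run q s' s'' t' → Run (.seq p q) s s'' (t + t')
  | condTrue {a b : ℕ} {p q : Prog} {s s' : State} {t : ℕ} :
      s.reg a < s.reg b → Run p s s' t → Run (.cond a b p q) s s' (t + 1)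
  | condFalse {a b : ℕ} {p q : Prog} {s s' : State} {t : ℕ} :
      ¬ s.reg a < s.reg b → Run q s s' t → Run (.cond a b p q) s s' (t + 1)
  | loopTrue {a b : ℕ} {p : Prog} {s s' s'' : State} {t t' : ℕ} :
      s.reg a < s.reg b → Run p s s' t → Run (.loop a b p) s' s'' t' →
      Run (.loop a b p) s s'' (t + t' + 1)
  | loopFalse {a b : ℕ} {p : Prog} {s : State} :
      ¬ s.reg a < s.reg b → Run (.loop a b p) s s 1

/-- Programs are deterministic: the final state and the number of steps are determined by the
program and the initial state. -/
theorem Run.deterministic {p : Prog} {s s₁ s₂ : State} {t₁ t₂ : ℕ}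
    (h₁ : Run p s s₁ t₁) (h₂ : Run p s s₂ t₂) : s₁ = s₂ ∧ t₁ = t₂ := by
  induction h₁ generalizing s₂ t₂ with
  | seq _ _ ih ih' =>
    cases h₂ with
    | seq k k' =>
      obtain ⟨rfl, rfl⟩ := ih k
      obtain ⟨rfl, rfl⟩ := ih' k'
      exact ⟨rfl, rfl⟩
  | condTrue h _ ih =>
    cases h₂ with
    | condTrue _ k => obtain ⟨rfl, rfl⟩ := ih k; exact ⟨rfl, rfl⟩
    | condFalse h' _ => exact absurd h h'
  | condFalse h _ ih =>
    cases h₂ with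
    | condTrue h' _ => exact absurd h' h
    | condFalse _ k => obtain ⟨rfl, rfl⟩ := ih k; exact ⟨rfl, rfl⟩
  | loopTrue h _ _ ih ih' =>
    cases h₂ with
    | loopTrue _ k k' =>
      obtain ⟨rfl, rfl⟩ := ih k
      obtain ⟨rfl, rfl⟩ := ih' k'
      exact ⟨rfl, rfl⟩
    | loopFalse h' => exact absurd h h'
  | loopFalse h =>
    cases h₂ with
    | loopTrue h' _ _ => exact absurd h' h
    | loopFalse _ => exact ⟨rfl, rfl⟩
  | _ => cases h₂; exact ⟨rfl, rfl⟩

/-! ### Decision problems and XP -/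

/-- A decision problem with instances `ι`: how an instance is presented to a program, its size,
and which instances are yes-instances. -/
structure Problem (ι : Type*) where
  input : ι → State
  size : ι → ℕ
  yes : ι → Prop

/-- On the instance `x` the program `p` halts after at most `T` steps with the correct answer in
register `0` (`1` for yes, `0` for no). -/
def Problem.SolvesWithin {ι : Type*} (L : Problem ι) (p : Prog) (x : ι) (T : ℕ) : Prop :=
  ∃ (s : State) (t : ℕ), Run p (L.input x) s t ∧ t ≤ T ∧
    ((L.yes x ∧ s.reg 0 = 1) ∨ (¬ L.yes x ∧ s.reg 0 = 0))

/-- The problem `L` has an XP algorithm with respect to the parameterization `κ`: there is one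
program (which is not given the value of the parameter) that solves every instance and, for every
fixed value of the parameter, runs in time polynomial in the size of the instance. -/
def Problem.HasXPAlgorithm {ι ρ : Type*} (L : Problem ι) (κ : ι → ρ) : Prop :=
  ∃ p : Prog, ∀ c : ρ, ∃ f : Polynomial ℕ, ∀ x : ι, κ x = c →
    L.SolvesWithin p x (f.eval (L.size x))

/-! ### The problem MatchingGap -/

/-- An instance of MatchingGap: a finite graph, with vertices numbered `0, …, n - 1`, and a
number `k`. -/
structure Instance where
  n : ℕ
  G : SimpleGraph (Fin n)
  k : ℕ

open Classical in
/-- The initial state: register `0` holds the number of vertices `n`, register `1` holds `k`, and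
the memory cells `0, …, n * n - 1` hold the adjacency matrix, row by row. All else is zero. -/
noncomputable def Instance.toState (x : Instance) : State where
  reg r := if r = 0 then x.n else if r = 1 then x.k else 0
  mem a := if ∃ i j : Fin x.n, a = i.val * x.n + j.val ∧ x.G.Adj i j then 1 else 0

/-- MatchingGap: given `G` and `k`, is `μ(G) ≥ k`? The size of an instance is the number of
vertices of `G`, which is at most the length of the usual encodings of `(G, k)`. -/
noncomputable def MatchingGap : Problem Instance where
  input := Instance.toState
  size x := x.n
  yes x := x.k ≤ matchingGap x.G

/-- The parameter `|V(G)| / 2 - β(G)`, a half-integer. -/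
noncomputable def halfOrderMinusMMM (x : Instance) : ℚ := (x.n : ℚ) / 2 - (mmmNumber x.G : ℚ)

end MatchingGapXP

namespace MatchingGapXP

/-! ### Matchings as involutions -/

section MatchingMaps

variable {V : Type*} {G : SimpleGraph V} {f g m : V → V}

/-! A maximal matching is treated as an involution whose fixed points, the uncovered vertices, form
an independent set. A matching with `u` fixed points has `(|V| - u) / 2` edges, so `ν` and `β` are
given by the least and the greatest number of uncovered vertices of a maximal matching. The greatest
number is `|V| - 2β`, twice the parameter.

The heart of the proof is a locality statement, `IsMaximalMap.exists_near`. Let `m` be a maximal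
matching with at most `B` uncovered vertices, and suppose that no maximal matching within `radius B`
of `m` (counting vertices on which the two differ) leaves more than `B` vertices uncovered. Then the
number of uncovered vertices of any maximal matching `N` also occurs within that radius.

For `N` with at most `B + 2` uncovered vertices, take `n` closest to `m` among the matchings with
the same uncovered vertices; it is again maximal. If `n` is far from `m`, then `m` and `n` contain a
long alternating path (`IsClosest.exists_chain`). By minimality the path has no shortcuts, which
forbids certain chords (`IsChain.not_adj`, `IsChain.not_adj_adj`). Ramsey's theorem
(`exists_homogeneous`) makes the remaining chords uniform on a large subset, and in each case `m`
can be changed on the path alone so that a large independent set `U` becomes uncovered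
(`IsChain.exists_exposes`). In a maximal extension, each covered vertex of `U` is matched to a
vertex that `m` leaves uncovered, so at most `B` vertices of `U` are lost
(`Exposes.exists_maximal`). The result is near `m` and has more than `B` uncovered vertices, a
contradiction. An `N` with more than `B + 2` uncovered vertices is reduced by augmentation, which
removes two of them at a time and preserves maximality (`exists_augment`).

The algorithm starts from a greedy maximal matching `m`. It searches the ball around `m` whose
radius is given by the largest number of uncovered vertices seen so far, and repeats until this
number no longer grows. By locality the recorded extremes are then global
(`SearchState.two_mul_eq`). The ball is enumerated through codes of bounded sequences of elementary
moves (`exists_codedMoves_eq`). The recorded maximum never exceeds twice the parameter, which bounds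
both the number of rounds and the degree of the polynomial without the parameter being known. -/

/-- A matching, given as the involution that maps every covered vertex to its partner and fixes
every uncovered vertex. -/
structure IsMatchingMap (G : SimpleGraph V) (f : V → V) : Prop where
  invol : ∀ v, f (f v) = v
  adj : ∀ v, f v ≠ v → G.Adj v (f v)

/-- A matching whose uncovered vertices form an independent set, that is, a maximal matching. -/
structure IsMaximalMap (G : SimpleGraph V) (f : V → V) : Prop extends IsMatchingMap G f where
  indep : ∀ v w, f v = v → f w = w → ¬ G.Adj v w

open Classical in
/-- The matching `g` on the set `S`, and outside `S` those edges of `f` that avoid `S`. -/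
noncomputable def override (f g : V → V) (S : Set V) (v : V) : V :=
  if v ∈ S then g v else if f v ∈ S then v else f v

theorem override_of_mem {S : Set V} {v : V} (h : v ∈ S) : override f g S v = g v := by
  simp [override, h]

theorem override_of_map_mem {S : Set V} {v : V} (h : v ∉ S) (h' : f v ∈ S) :
    override f g S v = v := by
  simp [override, h, h']

theorem override_of_not_mem {S : Set V} {v : V} (h : v ∉ S) (h' : f v ∉ S) :
    override f g S v = f v := by
  simp [override, h, h']

theorem IsMatchingMap.injective (hf : IsMatchingMap G f) : Function.Injective f := fun v w h => by
  rw [← hf.invol v, h, hf.invol]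

theorem IsMatchingMap.id : IsMatchingMap G (fun v => v) := ⟨fun _ => rfl, fun _ h => absurd rfl h⟩

theorem IsMatchingMap.swap [DecidableEq V] {a b : V} (h : G.Adj a b) :
    IsMatchingMap G (Equiv.swap a b) := by
  refine ⟨fun v => Equiv.swap_apply_self a b v, fun v hv => ?_⟩
  rcases eq_or_ne v a with rfl | ha
  · simpa using h
  rcases eq_or_ne v b with rfl | hb
  · simpa using h.symm
  exact absurd (Equiv.swap_apply_of_ne_of_ne ha hb) hv

theorem swap_mem_pair [DecidableEq V] {a b u : V} (hu : u ∈ ({a, b} : Set V)) :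
    Equiv.swap a b u ∈ ({a, b} : Set V) := by
  rcases hu with rfl | rfl <;> simp

/-- Closure of `S` under `g` keeps the new edges inside `S`. An edge of `f` with exactly one end in
`S` is dropped, and its other end becomes uncovered. -/
theorem IsMatchingMap.override (hf : IsMatchingMap G f) (hg : IsMatchingMap G g) {S : Set V}
    (hS : ∀ v ∈ S, g v ∈ S) : IsMatchingMap G (override f g S) := by
  constructor
  · intro v
    by_cases h : v ∈ S
    · rw [override_of_mem h, override_of_mem (hS v h), hg.invol]
    by_cases h' : f v ∈ S
    · rw [override_of_map_mem h h', override_of_map_mem h h']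
    · rw [override_of_not_mem h h', override_of_not_mem h' (by rwa [hf.invol]), hf.invol]
  · intro v hv
    by_cases h : v ∈ S
    · rw [override_of_mem h] at hv ⊢; exact hg.adj v hv
    by_cases h' : f v ∈ S
    · exact absurd (override_of_map_mem h h') hv
    · rw [override_of_not_mem h h'] at hv ⊢; exact hf.adj v hv

variable [Fintype V] [DecidableEq V]

/-- The uncovered vertices of a matching. -/
def uncovered (f : V → V) : Finset V := {v | f v = v}

/-- The vertices on which two matchings differ. -/
def diffSet (f g : V → V) : Finset V := {v | f v ≠ g v}

@[simp] theorem mem_uncovered {v : V} : v ∈ uncovered f ↔ f v = v := by simp [uncovered]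

@[simp] theorem mem_diffSet {v : V} : v ∈ diffSet f g ↔ f v ≠ g v := by simp [diffSet]

/-- Every matching extends to a maximal matching. -/
theorem IsMatchingMap.exists_maximal (hf : IsMatchingMap G f) :
    ∃ f', IsMaximalMap G f' ∧ ∀ v, f v ≠ v → f' v = f v := by
  induction hc : (uncovered f).card using Nat.strong_induction_on generalizing f with
  | _ c ih =>
    by_cases h : ∀ v w, f v = v → f w = w → ¬ G.Adj v w
    · exact ⟨f, ⟨hf, h⟩, fun _ _ => rfl⟩
    push Not at h
    obtain ⟨v, w, hv, hw, hvw⟩ := h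
    have hne := hvw.ne
    have key : ∀ u, f u ≠ u → MatchingGapXP.override f (Equiv.swap v w) {v, w} u = f u := by
      intro u hu
      refine override_of_not_mem ?_ ?_
      · rintro (rfl | rfl) <;> contradiction
      · rintro (h | h)
        · exact hu (by rw [← hf.invol u, h, hv, hv])
        · rw [Set.mem_singleton_iff] at h
          exact hu (by rw [← hf.invol u, h, hw, hw])
    have hlt : (uncovered (MatchingGapXP.override f (Equiv.swap v w) {v, w})).card < c := by
      rw [← hc]
      refine Finset.card_lt_card ⟨fun u hu => ?_, fun hsub => ?_⟩
      · rw [mem_uncovered] at hu ⊢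
        by_contra hcon
        exact hcon (by rw [← key u hcon]; exact hu)
      · have := hsub (mem_uncovered.2 hv)
        rw [mem_uncovered, override_of_mem (by simp), Equiv.swap_apply_left] at this
        exact hne this.symm
    obtain ⟨f', hf', hext⟩ := ih _ hlt (hf.override (IsMatchingMap.swap hvw) fun _ => swap_mem_pair) rfl
    exact ⟨f', hf', fun u hu => by rw [hext u (by rwa [key u hu]), key u hu]⟩

/-- If `m` covers more vertices than `f`, then two uncovered vertices of `f` can be covered by
augmenting `f` along an alternating path. -/
theorem exists_augment (hm : IsMatchingMap G m) (hf : IsMatchingMap G f)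
    (h : (uncovered m).card < (uncovered f).card) :
    ∃ f', IsMatchingMap G f' ∧ uncovered f' ⊆ uncovered f ∧
      (uncovered f').card + 2 = (uncovered f).card ∧ ∀ v, f' v = m v ∨ f' v = f v := by
  induction hc : (diffSet m f).card using Nat.strong_induction_on generalizing f with
  | _ c ih =>
    -- Walk along the alternating path that starts at a vertex `a` covered by `m` but not by `f`:
    -- its `m`-edge `a x` is forced into `f`.
    obtain ⟨a, ha, ham⟩ := Finset.exists_mem_notMem_of_card_lt_card h
    rw [mem_uncovered] at ha ham
    have hadj := hm.adj a ham
    have hxm : m (m a) = a := hm.invol a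
    set x := m a with hx
    set f₁ := MatchingGapXP.override f (Equiv.swap a x) {a, x} with hf₁
    have hmat : IsMatchingMap G f₁ := hf.override (IsMatchingMap.swap hadj) fun _ => swap_mem_pair
    have h₁a : f₁ a = x := by rw [hf₁, override_of_mem (by simp)]; simp
    have h₁x : f₁ x = a := by rw [hf₁, override_of_mem (by simp)]; simp
    have h₁ : ∀ v, v ≠ a → v ≠ x → f v ≠ x → f₁ v = f v := by
      intro v h1 h2 h3
      refine override_of_not_mem (by simp [h1, h2]) ?_
      rintro (h | h)
      · exact h1 (by rw [← hf.invol v, h, ha])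
      · exact h3 h
    by_cases hfx : f x = x
    · have h₁' : ∀ v, v ≠ a → v ≠ x → f₁ v = f v := fun v h1 h2 => h₁ v h1 h2 fun h3 =>
        h2 (by rw [← hf.invol v, h3, hfx])
      have hunc : uncovered f₁ = uncovered f \ {a, x} := by
        ext v
        by_cases hva : v = a
        · subst hva; simp [h₁a, ham]
        by_cases hvx : v = x
        · rw [hvx]; simp [h₁x, hadj.ne]
        simp [h₁' v hva hvx, hva, hvx]
      refine ⟨f₁, hmat, by rw [hunc]; exact Finset.sdiff_subset, ?_, fun v => ?_⟩
      · have : ({a, x} : Finset V) ⊆ uncovered f := by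
          intro v; simp only [Finset.mem_insert, Finset.mem_singleton, mem_uncovered]
          rintro (rfl | rfl) <;> assumption
        rw [hunc, Finset.card_sdiff_of_subset this]
        have h2 := Finset.card_le_card this
        rw [Finset.card_pair hadj.ne] at h2 ⊢
        omega
      · by_cases hva : v = a
        · subst hva; exact Or.inl h₁a
        by_cases hvx : v = x
        · rw [hvx]; exact Or.inl (h₁x.trans hxm.symm)
        exact Or.inr (h₁' v hva hvx)
    -- The vertex `x` loses its `f`-partner `y`, so `f₁` has `y` uncovered in place of `a`. It is
    -- closer to `m`, which allows induction.
    · set y := f x with hy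
      have hfy : f y = x := hf.invol x
      have hya : y ≠ a := fun h => hadj.ne (by rw [← ha, ← h, hfy])
      have h₁y : f₁ y = y := by
        refine override_of_map_mem (by simp [hya, hfx]) (by simp [hfy])
      have h₁' : ∀ v, v ≠ a → v ≠ x → v ≠ y → f₁ v = f v := fun v h1 h2 h3 => h₁ v h1 h2 fun h4 =>
        h3 (by rw [← hf.invol v, h4])
      have hunc : uncovered f₁ = insert y ((uncovered f).erase a) := by
        ext v
        by_cases hva : v = a
        · subst hva; simp [h₁a, ham, hya.symm]
        by_cases hvx : v = x
        · rw [hvx]; simp [h₁x, hadj.ne, ← hy, hfx, Ne.symm hfx]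
        by_cases hvy : v = y
        · subst hvy; simp [h₁y]
        simp [h₁' v hva hvx hvy, hva, hvy]
      have hcard : (uncovered f₁).card = (uncovered f).card := by
        rw [hunc, Finset.card_insert_of_notMem (by simp [hfy, Ne.symm hfx]),
          Finset.card_erase_of_mem (by simpa using ha)]
        have : 0 < (uncovered f).card := Finset.card_pos.2 ⟨a, by simpa using ha⟩
        omega
      have hlt : (diffSet m f₁).card < c := by
        rw [← hc]
        refine Finset.card_lt_card ⟨fun v => ?_, fun hsub => ?_⟩
        · rw [mem_diffSet, mem_diffSet]
          by_cases hva : v = a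
          · subst hva; simp [h₁a, ← hx]
          by_cases hvx : v = x
          · rw [hvx]; simp [h₁x, hxm]
          by_cases hvy : v = y
          · intro _ h3
            rw [hvy, hfy] at h3
            exact hya (by rw [← hm.invol y, h3, hxm])
          rw [h₁' v hva hvx hvy]; exact fun h => h
        · have := hsub (mem_diffSet.2 (show m a ≠ f a by rw [ha]; exact ham))
          rw [mem_diffSet, h₁a] at this
          exact this rfl
      obtain ⟨f', hf', hsub, hcard', hor⟩ := ih _ hlt hmat (by rwa [hcard]) rfl
      -- Both `m` and `f₁` contain the edge `a x`; this is where the last clause of the induction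
      -- statement is needed.
      have h'a : f' a = x := by rcases hor a with h | h <;> rw [h]; rw [h₁a]
      have h'x : f' x = a := by rw [← h'a, hf'.invol]
      -- If the inductive augmentation leaves `y` uncovered, the exchange is undone: `x y` replaces
      -- `a x`, so that the new uncovered set stays inside that of `f`.
      by_cases h'y : f' y = y
      · refine ⟨MatchingGapXP.override f' (Equiv.swap x y) {x, y},
          hf'.override (IsMatchingMap.swap (hf.adj x hfx)) (fun _ => swap_mem_pair), ?_⟩
        have ha' : MatchingGapXP.override f' (Equiv.swap x y) {x, y} a = a :=
          override_of_map_mem (by simp [hya.symm, hadj.ne]) (by simp [h'a])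
        have hx' : MatchingGapXP.override f' (Equiv.swap x y) {x, y} x = y := by
          rw [override_of_mem (by simp)]; simp
        have hy' : MatchingGapXP.override f' (Equiv.swap x y) {x, y} y = x := by
          rw [override_of_mem (by simp)]; simp
        have hv' : ∀ v, v ≠ a → v ≠ x → v ≠ y →
            MatchingGapXP.override f' (Equiv.swap x y) {x, y} v = f' v := by
          intro v h1 h2 h3
          refine override_of_not_mem (by simp [h2, h3]) ?_
          rintro (h | h)
          · exact h1 (by rw [← hf'.invol v, h, h'x])
          · exact h3 (by rw [← hf'.invol v, h, h'y])
        have hunc' : uncovered (MatchingGapXP.override f' (Equiv.swap x y) {x, y}) =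
            insert a ((uncovered f').erase y) := by
          ext v
          by_cases hva : v = a
          · rw [hva]; simp [ha']
          by_cases hvx : v = x
          · rw [hvx]; simp [hx', h'x, hfx, hadj.ne, hadj.ne.symm]
          by_cases hvy : v = y
          · rw [hvy]; simp [hy', hya, Ne.symm hfx]
          simp [hv' v hva hvx hvy, hva, hvy]
        refine ⟨?_, ?_, fun v => ?_⟩
        · rw [hunc']
          intro v hv
          rw [Finset.mem_insert, Finset.mem_erase] at hv
          rcases hv with rfl | ⟨hvy, hv⟩
          · simpa using ha
          · have := hsub hv
            rw [hunc, Finset.mem_insert] at this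
            exact Finset.mem_of_mem_erase (this.resolve_left hvy)
        · rw [hunc', Finset.card_insert_of_notMem (by simp [h'a, hadj.ne.symm]),
            Finset.card_erase_of_mem (by simpa using h'y)]
          have : 0 < (uncovered f').card := Finset.card_pos.2 ⟨y, by simpa using h'y⟩
          omega
        · by_cases hva : v = a
          · rw [hva, ha']; exact Or.inr ha.symm
          by_cases hvx : v = x
          · rw [hvx, hx']; exact Or.inr rfl
          by_cases hvy : v = y
          · rw [hvy, hy']; exact Or.inr hfy.symm
          rw [hv' v hva hvx hvy, ← h₁' v hva hvx hvy]
          exact hor v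
      · refine ⟨f', hf', fun v hv => ?_, by omega, fun v => ?_⟩
        · have := hsub hv
          rw [hunc, Finset.mem_insert] at this
          refine Finset.mem_of_mem_erase (this.resolve_left ?_)
          rintro rfl
          exact h'y (mem_uncovered.1 hv)
        · by_cases hva : v = a
          · rw [hva, h'a]; exact Or.inl rfl
          by_cases hvx : v = x
          · rw [hvx, h'x]; exact Or.inl hxm.symm
          by_cases hvy : v = y
          · rw [hvy]; exact Or.inl ((hor y).resolve_right (by rw [h₁y]; exact h'y))
          rw [← h₁' v hva hvx hvy]
          exact hor v

end MatchingMaps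
/-! ### Ramsey's theorem for colourings of pairs -/

section Ramsey

variable {κ : Type*} [Fintype κ] [DecidableEq κ]

/-- Take the least element, keep the most frequent colour class among the others, and iterate: each
step costs a factor `|κ|`. The colour of a pair then depends on its smaller member only. -/
theorem exists_end_homogeneous (col : ℕ → ℕ → κ) (t : ℕ) (S : Finset ℕ)
    (hS : Fintype.card κ ^ t ≤ S.card) (hκ : 1 < Fintype.card κ) :
    ∃ H ⊆ S, H.card = t ∧ ∃ φ : ℕ → κ, ∀ i ∈ H, ∀ j ∈ H, i < j → col i j = φ i := by
  induction t generalizing S with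
  | zero =>
    obtain ⟨c⟩ := Fintype.card_pos_iff.1 (zero_lt_one.trans hκ)
    exact ⟨∅, by simp, rfl, fun _ => c, by simp⟩
  | succ t ih =>
    have hpos : 0 < Fintype.card κ ^ t := pow_pos (zero_lt_one.trans hκ) t
    have hne : S.Nonempty := Finset.card_pos.1 (lt_of_lt_of_le (pow_pos (zero_lt_one.trans hκ) _) hS)
    set a := S.min' hne with ha
    have haS : a ∈ S := S.min'_mem hne
    obtain ⟨c, -, hc⟩ := Finset.exists_lt_card_fiber_of_mul_lt_card_of_maps_to
      (s := S.erase a) (t := Finset.univ) (f := col a) (n := Fintype.card κ ^ t - 1)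
      (fun _ _ => Finset.mem_univ _) (by
        rw [Finset.card_univ, Finset.card_erase_of_mem haS, Nat.mul_sub_one, ← pow_succ']
        have : Fintype.card κ ≤ Fintype.card κ ^ (t + 1) := Nat.le_self_pow (by omega) _
        omega)
    obtain ⟨H, hHS, hHt, φ, hφ⟩ := ih ((S.erase a).filter (col a · = c)) (by omega)
    have haH : a ∉ H := fun h => by simpa using hHS h
    refine ⟨insert a H, ?_, by rw [Finset.card_insert_of_notMem haH, hHt],
      Function.update φ a c, ?_⟩
    · intro i hi
      rcases Finset.mem_insert.1 hi with rfl | hi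
      · exact haS
      · exact Finset.mem_of_mem_erase (Finset.mem_filter.1 (hHS hi)).1
    · intro i hi j hj hij
      have hmin : ∀ k ∈ H, a < k := fun k hk => by
        have hk' := Finset.mem_erase.1 (Finset.mem_filter.1 (hHS hk)).1
        exact lt_of_le_of_ne (S.min'_le k hk'.2) (Ne.symm hk'.1)
      rcases Finset.mem_insert.1 hj with rfl | hj
      · rcases Finset.mem_insert.1 hi with rfl | hi
        · exact absurd hij (lt_irrefl _)
        · exact absurd hij (not_lt.2 (hmin i hi).le)
      rcases Finset.mem_insert.1 hi with rfl | hi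
      · rw [Function.update_self]; exact (Finset.mem_filter.1 (hHS hj)).2
      · rw [Function.update_of_ne (hmin i hi).ne']; exact hφ i hi j hj hij

/-- Ramsey's theorem: in a large set of numbers there is a large subset all of whose pairs have
the same colour. -/
theorem exists_homogeneous (col : ℕ → ℕ → κ) (r : ℕ) (S : Finset ℕ)
    (hS : Fintype.card κ ^ (Fintype.card κ * r) ≤ S.card) (hκ : 1 < Fintype.card κ) :
    ∃ H ⊆ S, H.card = r ∧ ∃ c, ∀ i ∈ H, ∀ j ∈ H, i < j → col i j = c := by
  obtain ⟨H, hHS, hH, φ, hφ⟩ := exists_end_homogeneous col _ S hS hκ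
  have : Nonempty κ := Fintype.card_pos_iff.1 (zero_lt_one.trans hκ)
  obtain ⟨c, -, hc⟩ := Finset.exists_le_card_fiber_of_mul_le_card_of_maps_to
    (s := H) (t := Finset.univ) (f := φ) (n := r) (fun _ _ => Finset.mem_univ _)
    Finset.univ_nonempty (by rw [Finset.card_univ, hH])
  obtain ⟨H', hH', hr⟩ := Finset.exists_subset_card_eq hc
  refine ⟨H', fun i hi => hHS (Finset.mem_filter.1 (hH' hi)).1, hr, c, fun i hi j hj hij => ?_⟩
  have hi' := Finset.mem_filter.1 (hH' hi)
  rw [hφ i hi'.1 j (Finset.mem_filter.1 (hH' hj)).1 hij, hi'.2]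

/-- A set of `r + q` numbers splits into its `r` smallest and its `q` largest elements. -/
theorem exists_split (r q : ℕ) (H : Finset ℕ) (hH : H.card = r + q) :
    ∃ A ⊆ H, ∃ B ⊆ H, A.card = r ∧ B.card = q ∧ ∀ a ∈ A, ∀ b ∈ B, a < b := by
  induction r generalizing H with
  | zero => exact ⟨∅, by simp, H, subset_rfl, rfl, by omega, by simp⟩
  | succ r ih =>
    have hne : H.Nonempty := Finset.card_pos.1 (by omega)
    have hmem := H.min'_mem hne
    obtain ⟨A, hA, B, hB, hr, hq, hlt⟩ := ih (H.erase (H.min' hne)) (by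
      rw [Finset.card_erase_of_mem hmem]; omega)
    refine ⟨insert (H.min' hne) A, ?_, B, hB.trans (Finset.erase_subset _ _), ?_, hq, ?_⟩
    · exact Finset.insert_subset hmem (hA.trans (Finset.erase_subset _ _))
    · rw [Finset.card_insert_of_notMem (fun h => by simpa using hA h), hr]
    · intro a ha b hb
      rcases Finset.mem_insert.1 ha with rfl | ha
      · have hb' := Finset.mem_erase.1 (hB hb)
        exact lt_of_le_of_ne (H.min'_le b hb'.2) (Ne.symm hb'.1)
      · exact hlt a ha b hb

end Ramsey
/-! ### Alternating chains -/

section Chains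

variable {V : Type*} {G : SimpleGraph V} {m n : V → V}

/-- The vertices `x 0, m (x 0), x 1, m (x 1), …` are distinct and form an alternating path of
length `ℓ` with respect to the matchings `m` and `n`. -/
structure IsChain (m n : V → V) (x : ℕ → V) (ℓ : ℕ) : Prop where
  next : ∀ i < ℓ, n (m (x i)) = x (i + 1)
  ne : ∀ i < ℓ, ∀ j < ℓ, x i ≠ m (x j)
  inj : ∀ i < ℓ, ∀ j < ℓ, x i = x j → i = j

variable {x : ℕ → V} {ℓ : ℕ}

/-- The vertices of a chain strictly after `x i` and up to `x j`. -/
def between (m : V → V) (x : ℕ → V) (i j : ℕ) : Set V :=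
  {v | ∃ t, i ≤ t ∧ t < j ∧ (v = m (x t) ∨ v = x (t + 1))}

/-- The segment runs from `m (x i)` to `x j`, so it begins and ends with an edge of `n` and is a
union of such edges. -/
theorem IsChain.map_mem_between (hc : IsChain m n x ℓ) (hn : ∀ v, n (n v) = v) {i j : ℕ}
    (hj : j < ℓ) : ∀ v ∈ between m x i j, n v ∈ between m x i j := by
  rintro v ⟨t, h1, h2, rfl | rfl⟩
  · exact ⟨t, h1, h2, Or.inr (hc.next t (by omega))⟩
  · exact ⟨t, h1, h2, Or.inl (by rw [← hc.next t (by omega), hn])⟩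

theorem IsChain.map_ne_of_mem_between (hc : IsChain m n x ℓ) (hn : ∀ v, n (n v) = v) {i j : ℕ}
    (hj : j < ℓ) : ∀ v ∈ between m x i j, n v ≠ v := by
  rintro v ⟨t, h1, h2, rfl | rfl⟩
  · rw [hc.next t (by omega)]; exact hc.ne _ (by omega) _ (by omega)
  · rw [← hc.next t (by omega), hn, hc.next t (by omega)]
    exact (hc.ne _ (by omega) _ (by omega)).symm

theorem IsChain.ne_of_mem_between (hc : IsChain m n x ℓ) (hm : ∀ v, m (m v) = v)
    (hn : ∀ v, n (n v) = v) {i j : ℕ} (hj : j < ℓ) : ∀ v ∈ between m x i j, m v ≠ n v := by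
  rintro v ⟨t, h1, h2, rfl | rfl⟩
  · rw [hc.next t (by omega), hm]
    exact fun h => absurd (hc.inj _ (by omega) _ (by omega) h) (by omega)
  · nth_rw 2 [← hc.next t (by omega)]
    rw [hn]
    intro h
    have := congrArg m h
    rw [hm, hm] at this
    exact absurd (hc.inj _ (by omega) _ (by omega) this) (by omega)

variable [Fintype V] [DecidableEq V]

/-- `n` is a matching that is closest to `m` among those with the same uncovered vertices. -/
def IsClosest (G : SimpleGraph V) (m n : V → V) : Prop :=
  IsMatchingMap G n ∧ ∀ n', IsMatchingMap G n' → uncovered n' = uncovered n →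
    (diffSet m n).card ≤ (diffSet m n').card

/-- Replacing `n` by `g` on `S` changes no uncovered vertex. As `n` disagrees with `m` everywhere on
`S`, the distance to `m` cannot grow, and it drops at `w`, against the choice of `n`. -/
theorem IsClosest.no_shortcut (hn : IsClosest G m n) {g : V → V} (hg : IsMatchingMap G g)
    {S : Set V} (hgS : ∀ v ∈ S, g v ∈ S) (hnS : ∀ v ∈ S, n v ∈ S) (hgf : ∀ v ∈ S, g v ≠ v)
    (hnf : ∀ v ∈ S, n v ≠ v) (hne : ∀ v ∈ S, m v ≠ n v) {w : V} (hwS : w ∈ S) (hw : g w = m w) :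
    False := by
  have hout : ∀ v ∉ S, override n g S v = n v := fun v hv =>
    override_of_not_mem hv fun h => hv (by rw [← hn.1.invol v]; exact hnS _ h)
  have h := hn.2 _ (hn.1.override hg hgS) (by
    ext v
    by_cases hv : v ∈ S
    · simp [override_of_mem hv, hgf v hv, hnf v hv]
    · simp [hout v hv])
  refine absurd h (not_le.2 (Finset.card_lt_card ⟨fun v hv => ?_, fun hsub => ?_⟩))
  · rw [mem_diffSet] at hv ⊢
    by_cases hvS : v ∈ S
    · exact hne v hvS
    · rwa [hout v hvS] at hv
  · have := hsub (mem_diffSet.2 (hne w hwS))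
    rw [mem_diffSet, override_of_mem hwS, hw] at this
    exact this rfl

/-- A shortest alternating chain has no forward chord from `m (x i)` to `x j`. -/
theorem IsChain.not_adj (hc : IsChain m n x ℓ) (hm : IsMatchingMap G m) (hn : IsClosest G m n)
    {i j : ℕ} (hij : i + 1 < j) (hj : j < ℓ) : ¬ G.Adj (m (x i)) (x j) := by
  intro hadj
  have hyy : ∀ {s t}, s < ℓ → t < ℓ → m (x s) = m (x t) → s = t := fun hs ht h =>
    hc.inj _ hs _ ht (hm.injective h)
  -- Apart from its two ends, the segment is a union of edges of `m`; the chord matches the ends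
  -- with each other.
  have hval : ∀ v ∈ between m x i j, (v = m (x i) ∨ v = x j) ∨ (v ≠ m (x i) ∧ v ≠ x j) ∧
      m v ≠ m (x i) ∧ m v ≠ x j ∧ m v ∈ between m x i j := by
    rintro v ⟨t, h1, h2, rfl | rfl⟩
    · rcases eq_or_lt_of_le h1 with rfl | h1
      · simp
      · refine Or.inr ⟨⟨fun h => ?_, (hc.ne _ (by omega) _ (by omega)).symm⟩, ?_, ?_, ?_⟩
        · have := hyy (by omega) (by omega) h; omega
        · rw [hm.invol]; exact hc.ne _ (by omega) _ (by omega)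
        · rw [hm.invol]; intro h; have := hc.inj _ (by omega) _ (by omega) h; omega
        · rw [hm.invol]; exact ⟨t - 1, by omega, by omega, Or.inr (by congr 1; omega)⟩
    · rcases eq_or_lt_of_le (show t + 1 ≤ j from h2) with rfl | h2
      · simp
      · refine Or.inr ⟨⟨hc.ne _ (by omega) _ (by omega), fun h => ?_⟩, fun h => ?_,
          (hc.ne _ (by omega) _ (by omega)).symm, ⟨t + 1, by omega, by omega, Or.inl rfl⟩⟩
        · have := hc.inj _ (by omega) _ (by omega) h; omega
        · have := hyy (by omega) (by omega) h; omega
  set g := override m (Equiv.swap (m (x i)) (x j)) {m (x i), x j} with hg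
  have hmi : m (x i) ∈ between m x i j := ⟨i, le_rfl, by omega, Or.inl rfl⟩
  have hxj : x j ∈ between m x i j :=
    ⟨j - 1, by omega, by omega, Or.inr (by congr 1; omega)⟩
  have hgi : g (m (x i)) = x j := by rw [hg, override_of_mem (by simp)]; simp
  have hgj : g (x j) = m (x i) := by rw [hg, override_of_mem (by simp)]; simp
  have hgv : ∀ v, (v ≠ m (x i) ∧ v ≠ x j) ∧ m v ≠ m (x i) ∧ m v ≠ x j ∧ m v ∈ between m x i j →
      g v = m v := fun v h => override_of_not_mem (by simp [h.1]) (by simp [h.2.1, h.2.2.1])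
  refine hn.no_shortcut (hm.override (IsMatchingMap.swap hadj) fun _ => swap_mem_pair)
    (S := between m x i j) ?_ (hc.map_mem_between hn.1.invol hj) ?_
    (hc.map_ne_of_mem_between hn.1.invol hj) (hc.ne_of_mem_between hm.invol hn.1.invol hj)
    -- The gap `i + 1 < j` makes `x (i + 1)` an inner vertex, where the new matching agrees with
    -- `m`.
    (w := x (i + 1)) ⟨i, le_rfl, by omega, Or.inr rfl⟩ ?_
  · intro v hv
    rcases hval v hv with (rfl | rfl) | h
    · rw [← hg, hgi]; exact hxj
    · rw [← hg, hgj]; exact hmi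
    · rw [← hg, hgv v h]; exact h.2.2.2
  · intro v hv
    rcases hval v hv with (rfl | rfl) | h
    · rw [← hg, hgi]; exact hc.ne _ (by omega) _ (by omega)
    · rw [← hg, hgj]; exact (hc.ne _ (by omega) _ (by omega)).symm
    · rw [← hg, hgv v h]
      obtain ⟨t, h1, h2, rfl | rfl⟩ := hv
      · rw [hm.invol]; exact hc.ne _ (by omega) _ (by omega)
      · exact (hc.ne _ (by omega) _ (by omega)).symm
  · rw [← hg]
    refine hgv _ ((hval _ ⟨i, le_rfl, by omega, Or.inr rfl⟩).resolve_left ?_)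
    rintro (h | h)
    · exact hc.ne _ (by omega) _ (by omega) h
    · have := hc.inj _ (by omega) _ (by omega) h; omega

/-- In a shortest alternating chain, a chord from `m (x i)` to `m (x j)` cannot be combined with
a chord from `x j` to `x l`. -/
theorem IsChain.not_adj_adj (hc : IsChain m n x ℓ) (hm : IsMatchingMap G m)
    (hn : IsClosest G m n) {i j l : ℕ} (hij : i + 1 < j) (hjl : j < l) (hl : l < ℓ)
    (h₁ : G.Adj (m (x i)) (m (x j))) (h₂ : G.Adj (x j) (x l)) : False := by
  have hyy : ∀ {s t}, s < ℓ → t < ℓ → s ≠ t → m (x s) ≠ m (x t) := fun hs ht hne h =>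
    hne (hc.inj _ hs _ ht (hm.injective h))
  have hxx : ∀ {s t}, s < ℓ → t < ℓ → s ≠ t → x s ≠ x t := fun hs ht hne h =>
    hne (hc.inj _ hs _ ht h)
  have hxy : ∀ {s t}, s < ℓ → t < ℓ → x s ≠ m (x t) := fun hs ht => hc.ne _ hs _ ht
  have hyx : ∀ {s t}, s < ℓ → t < ℓ → m (x s) ≠ x t := fun hs ht => (hc.ne _ ht _ hs).symm
  -- The segment from `m (x i)` to `x l` is rematched by the two chords and otherwise by `m`: the
  -- first chord takes `m (x j)` and the second takes its `m`-partner `x j`.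
  set g₁ := override m (Equiv.swap (m (x i)) (m (x j))) {m (x i), m (x j)} with hg₁
  set g := override g₁ (Equiv.swap (x j) (x l)) {x j, x l} with hg
  have hg₁x : ∀ t < ℓ, t ≠ i → t ≠ j → g₁ (x t) = m (x t) := fun t h1 h2 h3 =>
    override_of_not_mem (by simp [hxy h1 (show i < ℓ by omega), hxy h1 (show j < ℓ by omega)])
      (by simp [hyy h1 (show i < ℓ by omega) h2, hyy h1 (show j < ℓ by omega) h3])
  have hg₁y : ∀ t < ℓ, t ≠ i → t ≠ j → g₁ (m (x t)) = x t := fun t h1 h2 h3 => by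
    rw [hg₁, override_of_not_mem (by
      simp [hyy h1 (show i < ℓ by omega) h2, hyy h1 (show j < ℓ by omega) h3]) (by
      simp [hm.invol, hxy h1 (show i < ℓ by omega), hxy h1 (show j < ℓ by omega)]), hm.invol]
  have hg₁i : g₁ (m (x i)) = m (x j) := by rw [hg₁, override_of_mem (by simp)]; simp
  have hg₁j : g₁ (m (x j)) = m (x i) := by rw [hg₁, override_of_mem (by simp)]; simp
  have hgx : ∀ t < ℓ, t ≠ i → t ≠ j → t ≠ l → g (x t) = m (x t) := fun t h1 h2 h3 h4 => by
    rw [hg, override_of_not_mem (by simp [hxx h1 (show j < ℓ by omega) h3, hxx h1 hl h4]) (by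
      simp [hg₁x t h1 h2 h3, hyx h1 (show j < ℓ by omega), hyx h1 hl]), hg₁x t h1 h2 h3]
  have hgy : ∀ t < ℓ, t ≠ i → t ≠ j → t ≠ l → g (m (x t)) = x t := fun t h1 h2 h3 h4 => by
    rw [hg, override_of_not_mem (by simp [hyx h1 (show j < ℓ by omega), hyx h1 hl]) (by
      simp [hg₁y t h1 h2 h3, hxx h1 (show j < ℓ by omega) h3, hxx h1 hl h4]), hg₁y t h1 h2 h3]
  have hi : i < ℓ := by omega
  have hj : j < ℓ := by omega
  have hgi : g (m (x i)) = m (x j) := by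
    rw [hg, override_of_not_mem (by simp [hyx hi hj, hyx hi hl]) (by
      simp [hg₁i, hyx hj hj, hyx hj hl]), hg₁i]
  have hgj : g (m (x j)) = m (x i) := by
    rw [hg, override_of_not_mem (by simp [hyx hj hj, hyx hj hl]) (by
      simp [hg₁j, hyx hi hj, hyx hi hl]), hg₁j]
  have hgxj : g (x j) = x l := by rw [hg, override_of_mem (by simp)]; simp
  have hgxl : g (x l) = x j := by rw [hg, override_of_mem (by simp)]; simp
  have hmat : IsMatchingMap G g :=
    (hm.override (IsMatchingMap.swap h₁) fun _ => swap_mem_pair).override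
      (IsMatchingMap.swap h₂) fun _ => swap_mem_pair
  have hymem : ∀ t, i ≤ t → t < l → m (x t) ∈ between m x i l := fun t h1 h2 =>
    ⟨t, h1, h2, Or.inl rfl⟩
  have hxmem : ∀ t, i < t → t ≤ l → x t ∈ between m x i l := fun t h1 h2 =>
    ⟨t - 1, by omega, by omega, Or.inr (by congr 1; omega)⟩
  have hval : ∀ v ∈ between m x i l, g v ∈ between m x i l ∧ g v ≠ v := by
    rintro v ⟨t, h1, h2, rfl | rfl⟩
    · by_cases hti : t = i
      · subst hti; rw [hgi]; exact ⟨hymem j (by omega) hjl, hyy hj hi (by omega)⟩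
      by_cases htj : t = j
      · subst htj; rw [hgj]; exact ⟨hymem i le_rfl (by omega), hyy hi hj (by omega)⟩
      rw [hgy t (by omega) hti htj (by omega)]
      exact ⟨hxmem t (by omega) (by omega), hxy (by omega) (by omega)⟩
    · by_cases htj : t + 1 = j
      · rw [htj, hgxj]; exact ⟨hxmem l (by omega) le_rfl, hxx hl hj (by omega)⟩
      by_cases htl : t + 1 = l
      · rw [htl, hgxl]; exact ⟨hxmem j (by omega) (by omega), hxx hj hl (by omega)⟩
      rw [hgx (t + 1) (by omega) (by omega) htj htl]
      exact ⟨hymem (t + 1) (by omega) (by omega), hyx (by omega) (by omega)⟩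
  exact hn.no_shortcut hmat (fun v hv => (hval v hv).1) (hc.map_mem_between hn.1.invol hl)
    (fun v hv => (hval v hv).2) (hc.map_ne_of_mem_between hn.1.invol hl)
    (hc.ne_of_mem_between hm.invol hn.1.invol hl) (hxmem (i + 1) (by omega) (by omega))
    (hgx (i + 1) (by omega) (by omega) (by omega) (by omega))

end Chains
-- Uncovering a large independent set by local changes of a matching
section Expose

variable {V : Type*} [DecidableEq V] {G : SimpleGraph V} {m n : V → V}

/-- The matching `f` agrees with `m` outside `Z` and leaves uncovered, in addition to the vertices
that `m` leaves uncovered, the vertices of the independent set `U`. -/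
structure Exposes (G : SimpleGraph V) (m : V → V) (Z U : Finset V) (f : V → V) : Prop where
  isMatching : IsMatchingMap G f
  fixed : ∀ v, f v = v ↔ m v = v ∨ v ∈ U
  indep : ∀ v ∈ U, ∀ w ∈ U, ¬ G.Adj v w
  agree : ∀ v ∉ Z, f v = m v

theorem exists_isMatchingMap_of_complete {A B : Finset V} (hcard : A.card = B.card)
    (hdisj : Disjoint A B) (hadj : ∀ a ∈ A, ∀ b ∈ B, G.Adj a b) :
    ∃ g, IsMatchingMap G g ∧ ∀ v, v ∈ A ∨ v ∈ B → (g v ∈ A ∨ g v ∈ B) ∧ g v ≠ v := by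
  let e : A ≃ B := Finset.equivOfCardEq hcard
  let g : V → V := fun v =>
    if h : v ∈ A then e ⟨v, h⟩ else if h : v ∈ B then e.symm ⟨v, h⟩ else v
  have hgA : ∀ v (h : v ∈ A), g v = e ⟨v, h⟩ := fun v h => by simp [g, h]
  have hgB : ∀ v (h : v ∈ B), g v = e.symm ⟨v, h⟩ := fun v h => by
    have := Finset.disjoint_right.1 hdisj h
    simp [g, h, this]
  have hgn : ∀ v, v ∉ A → v ∉ B → g v = v := fun v h h' => by simp [g, h, h']
  have hA : ∀ v (h : v ∈ A), g v ∈ B := fun v h => by rw [hgA v h]; exact (e ⟨v, h⟩).2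
  have hB : ∀ v (h : v ∈ B), g v ∈ A := fun v h => by rw [hgB v h]; exact (e.symm ⟨v, h⟩).2
  refine ⟨g, ⟨fun v => ?_, fun v hv => ?_⟩, ?_⟩
  · by_cases h : v ∈ A
    · rw [hgB _ (hA v h)]; simp [hgA v h]
    by_cases h' : v ∈ B
    · rw [hgA _ (hB v h')]; simp [hgB v h']
    rw [hgn v h h', hgn v h h']
  · by_cases h : v ∈ A
    · exact hadj v h _ (hA v h)
    by_cases h' : v ∈ B
    · exact (hadj _ (hB v h') v h').symm
    exact absurd (hgn v h h') hv
  · rintro v (h | h)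
    · exact ⟨Or.inr (hA v h), fun h' => Finset.disjoint_left.1 hdisj h (h' ▸ hA v h)⟩
    · exact ⟨Or.inl (hB v h), fun h' => Finset.disjoint_left.1 hdisj (h' ▸ hB v h) h⟩

/-- If two halves of a family of vertices are completely joined, they can be matched with each
other, which exposes their former partners. -/
theorem exists_exposes_of_complete (hm : IsMatchingMap G m) {A₀ B₀ : Finset ℕ} {P : ℕ → V}
    (hcard : A₀.card = B₀.card) (hdisj : Disjoint A₀ B₀)
    (hinj : ∀ i ∈ A₀ ∪ B₀, ∀ j ∈ A₀ ∪ B₀, P i = P j → i = j)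
    (hne : ∀ i ∈ A₀ ∪ B₀, ∀ j ∈ A₀ ∪ B₀, P i ≠ m (P j))
    (hadj : ∀ i ∈ A₀, ∀ j ∈ B₀, G.Adj (P i) (P j))
    (hind : ∀ i ∈ A₀ ∪ B₀, ∀ j ∈ A₀ ∪ B₀, ¬ G.Adj (m (P i)) (m (P j))) {Z : Finset V}
    (hZ : ∀ i ∈ A₀ ∪ B₀, P i ∈ Z ∧ m (P i) ∈ Z) :
    ∃ f U, Exposes G m Z U f ∧ U.card = A₀.card + B₀.card := by
  have hA : ∀ i ∈ A₀, i ∈ A₀ ∪ B₀ := fun i hi => Finset.mem_union_left _ hi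
  have hB : ∀ i ∈ B₀, i ∈ A₀ ∪ B₀ := fun i hi => Finset.mem_union_right _ hi
  obtain ⟨g, hg, hgS⟩ := exists_isMatchingMap_of_complete (G := G) (A := A₀.image P)
    (B := B₀.image P) (by
      rw [Finset.card_image_of_injOn fun i hi j hj h => hinj i (hA i hi) j (hA j hj) h,
        Finset.card_image_of_injOn fun i hi j hj h => hinj i (hB i hi) j (hB j hj) h, hcard]) (by
      rw [Finset.disjoint_left]
      intro v hv hv'
      obtain ⟨i, hi, rfl⟩ := Finset.mem_image.1 hv
      obtain ⟨j, hj, h⟩ := Finset.mem_image.1 hv'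
      have := hinj j (hB j hj) i (hA i hi) h
      exact Finset.disjoint_left.1 hdisj hi (this ▸ hj)) (by
      intro a ha b hb
      obtain ⟨i, hi, rfl⟩ := Finset.mem_image.1 ha
      obtain ⟨j, hj, rfl⟩ := Finset.mem_image.1 hb
      exact hadj i hi j hj)
  have hmem : ∀ v, (v ∈ A₀.image P ∨ v ∈ B₀.image P) ↔ v ∈ (A₀ ∪ B₀).image P := fun v => by
    rw [Finset.image_union, Finset.mem_union]
  simp only [hmem] at hgS
  set S : Set V := {v | v ∈ (A₀ ∪ B₀).image P} with hS
  have hPS : ∀ i ∈ A₀ ∪ B₀, P i ∈ S := fun i hi => Finset.mem_image_of_mem _ hi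
  have hmS : ∀ i ∈ A₀ ∪ B₀, m (P i) ∉ S := fun i hi h => by
    obtain ⟨j, hj, h⟩ := Finset.mem_image.1 h
    exact hne j hj i hi h
  refine ⟨override m g S, (A₀ ∪ B₀).image fun i => m (P i),
    ⟨hm.override hg fun v hv => (hgS v hv).1, fun v => ?_, ?_, fun v hv => ?_⟩, ?_⟩
  · by_cases hv : v ∈ S
    · obtain ⟨i, hi, rfl⟩ := Finset.mem_image.1 hv
      rw [override_of_mem hv]
      refine iff_of_false (hgS _ hv).2 ?_
      rintro (h | h)
      · exact hne i hi i hi h.symm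
      · obtain ⟨j, hj, h⟩ := Finset.mem_image.1 h
        exact hne i hi j hj h.symm
    by_cases hv' : m v ∈ S
    · rw [override_of_map_mem hv hv']
      refine iff_of_true rfl (Or.inr ?_)
      obtain ⟨i, hi, h⟩ := Finset.mem_image.1 hv'
      exact Finset.mem_image.2 ⟨i, hi, by rw [h, hm.invol]⟩
    · rw [override_of_not_mem hv hv']
      refine ⟨Or.inl, fun h => h.resolve_right fun h => ?_⟩
      obtain ⟨i, hi, rfl⟩ := Finset.mem_image.1 h
      rw [hm.invol] at hv'
      exact hv' (hPS i hi)
  · intro v hv w hw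
    obtain ⟨i, hi, rfl⟩ := Finset.mem_image.1 hv
    obtain ⟨j, hj, rfl⟩ := Finset.mem_image.1 hw
    exact hind i hi j hj
  · refine override_of_not_mem (fun h => ?_) fun h => ?_
    · obtain ⟨i, hi, rfl⟩ := Finset.mem_image.1 h
      exact hv (hZ i hi).1
    · obtain ⟨i, hi, h⟩ := Finset.mem_image.1 h
      refine hv ?_
      rw [← hm.invol v, ← h]
      exact (hZ i hi).2
  · rw [Finset.card_image_of_injOn fun i hi j hj h => hinj i hi j hj (hm.injective h),
      Finset.card_union_of_disjoint hdisj]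

variable {x : ℕ → V} {ℓ : ℕ}

/-- Shifting `m` along the segments of a chain between the `1`st and the `2`nd, the `3`rd and the
`4`th, … member of `H` exposes one of the two vertices of the chain at every member of `H`. -/
theorem IsChain.exists_exposes_of_shift (hc : IsChain m n x ℓ) (hm : IsMatchingMap G m)
    (hn : IsMatchingMap G n) {H : Finset ℕ} (hH : ∀ h ∈ H, h < ℓ) (heven : Even H.card)
    (hxx : ∀ i ∈ H, ∀ j ∈ H, i < j → ¬ G.Adj (x i) (x j))
    (hyy : ∀ i ∈ H, ∀ j ∈ H, i < j → ¬ G.Adj (m (x i)) (m (x j)))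
    (hxy : ∀ i ∈ H, ∀ j ∈ H, i < j → ¬ G.Adj (x i) (m (x j)))
    (hyx : ∀ i ∈ H, ∀ j ∈ H, i < j → ¬ G.Adj (m (x i)) (x j)) {Z : Finset V}
    (hZ : ∀ i < ℓ, x i ∈ Z ∧ m (x i) ∈ Z) :
    ∃ f U, Exposes G m Z U f ∧ U.card = H.card := by
  -- The parity of the number of members of `H` below `s` tells whether position `s` lies in a
  -- shifted segment.
  set c : ℕ → ℕ := fun s => (H.filter (· < s)).card with hcdef
  have hc0 : c 0 = 0 := by simp [hcdef]
  have hcs : ∀ s ∈ H, c (s + 1) = c s + 1 := fun s hs => by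
    have : H.filter (· < s + 1) = insert s (H.filter (· < s)) := by
      ext t
      simp only [Finset.mem_filter, Finset.mem_insert]
      constructor
      · rintro ⟨h1, h2⟩; by_cases h : t = s
        · exact Or.inl h
        · exact Or.inr ⟨h1, by omega⟩
      · rintro (rfl | ⟨h1, h2⟩)
        · exact ⟨hs, by omega⟩
        · exact ⟨h1, by omega⟩
    simp only [hcdef]
    rw [this, Finset.card_insert_of_notMem (by simp)]
  have hcs' : ∀ s ∉ H, c (s + 1) = c s := fun s hs => by
    simp only [hcdef]
    congr 1
    ext t
    simp only [Finset.mem_filter]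
    refine and_congr_right fun ht => ?_
    have : t ≠ s := fun h => hs (h ▸ ht)
    omega
  -- Since `H` has even size, the last segment is closed before the end of the chain.
  have hlt : ∀ s, Odd (c (s + 1)) → s + 1 < ℓ := fun s hs => by
    by_contra hcon
    have : H.filter (· < s + 1) = H := Finset.filter_true_of_mem fun h hh => by
      have := hH h hh; omega
    simp only [hcdef, this] at hs
    exact Nat.not_odd_iff_even.2 heven hs
  set S : Set V := {v | ∃ s, Odd (c (s + 1)) ∧ (v = m (x s) ∨ v = x (s + 1))} with hS
  have hnS : ∀ v ∈ S, n v ∈ S ∧ n v ≠ v := by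
    rintro v ⟨s, hs, hv⟩
    have h1 := hlt s hs
    have hv' : v ∈ between m x s (s + 1) := ⟨s, le_rfl, by omega, hv⟩
    refine ⟨?_, hc.map_ne_of_mem_between hn.invol h1 v hv'⟩
    obtain ⟨t, h2, h3, h⟩ := hc.map_mem_between hn.invol h1 v hv'
    obtain rfl : t = s := by omega
    exact ⟨t, hs, h⟩
  have hxS : ∀ s < ℓ, x s ∈ S ↔ Odd (c s) := fun s hsℓ => by
    constructor
    · rintro ⟨t, ht, h | h⟩
      · exact absurd h (hc.ne _ hsℓ _ (by have := hlt t ht; omega))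
      · rwa [hc.inj _ hsℓ _ (hlt t ht) h]
    · intro h
      cases s with
      | zero => simp [hc0] at h
      | succ s => exact ⟨s, h, Or.inr rfl⟩
  have hyS : ∀ s < ℓ, m (x s) ∈ S ↔ Odd (c (s + 1)) := fun s hsℓ => by
    constructor
    · rintro ⟨t, ht, h | h⟩
      · rwa [hc.inj _ hsℓ _ (by have := hlt t ht; omega) (hm.injective h)]
      · exact absurd h.symm (hc.ne _ (hlt t ht) _ hsℓ)
    · exact fun h => ⟨s, h, Or.inl rfl⟩
  -- At a member of `H` the parity flips, so exactly one of `x h` and `m (x h)` lies in `S`. The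
  -- other one loses its partner: `x h` where a segment opens, `m (x h)` where it closes.
  set P : ℕ → V := fun h => if Odd (c (h + 1)) then x h else m (x h) with hP
  have hPS : ∀ h ∈ H, P h ∉ S ∧ m (P h) ∈ S := by
    intro h hh
    have h1 := hH h hh
    by_cases hodd : Odd (c (h + 1))
    · simp only [hP, if_pos hodd]
      rw [hxS h h1, hyS h h1]
      rw [hcs h hh] at hodd ⊢
      refine ⟨fun h' => ?_, hodd⟩
      exact Nat.not_odd_iff_even.2 (h'.add_odd odd_one) hodd
    · simp only [hP, if_neg hodd]
      rw [hyS h h1, hm.invol, hxS h h1]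
      refine ⟨hodd, ?_⟩
      rw [hcs h hh, Nat.not_odd_iff_even] at hodd
      by_contra h'
      rw [Nat.not_odd_iff_even] at h'
      exact Nat.not_even_iff_odd.2 (h'.add_odd odd_one) hodd
  have hPcases : ∀ h, P h = x h ∨ P h = m (x h) := fun h => by
    by_cases hodd : Odd (c (h + 1))
    · exact Or.inl (if_pos hodd)
    · exact Or.inr (if_neg hodd)
  have hPinj : ∀ i ∈ H, ∀ j ∈ H, P i = P j → i = j := by
    intro i hi j hj h
    rcases hPcases i with h1 | h1 <;> rcases hPcases j with h2 | h2 <;> rw [h1, h2] at h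
    · exact hc.inj _ (hH i hi) _ (hH j hj) h
    · exact absurd h (hc.ne _ (hH i hi) _ (hH j hj))
    · exact absurd h.symm (hc.ne _ (hH j hj) _ (hH i hi))
    · exact hc.inj _ (hH i hi) _ (hH j hj) (hm.injective h)
  have hPlt : ∀ i ∈ H, ∀ j ∈ H, i < j → ¬ G.Adj (P i) (P j) := by
    intro i hi j hj hij
    rcases hPcases i with h1 | h1 <;> rcases hPcases j with h2 | h2 <;> rw [h1, h2]
    · exact hxx i hi j hj hij
    · exact hxy i hi j hj hij
    · exact hyx i hi j hj hij
    · exact hyy i hi j hj hij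
  refine ⟨override m n S, H.image P,
    ⟨hm.override hn fun v hv => (hnS v hv).1, fun v => ?_, ?_, fun v hv => ?_⟩, ?_⟩
  · by_cases hv : v ∈ S
    · rw [override_of_mem hv]
      refine iff_of_false (hnS v hv).2 ?_
      rintro (h | h)
      · obtain ⟨s, hs, rfl | rfl⟩ := hv <;> have := hlt s hs
        · rw [hm.invol] at h
          exact hc.ne _ (by omega) _ (by omega) h
        · exact hc.ne _ (by omega) _ (by omega) h.symm
      · obtain ⟨i, hi, rfl⟩ := Finset.mem_image.1 h
        exact (hPS i hi).1 hv
    by_cases hv' : m v ∈ S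
    · rw [override_of_map_mem hv hv']
      refine iff_of_true rfl (Or.inr (Finset.mem_image.2 ?_))
      obtain ⟨s, hs, h | h⟩ := hv' <;> have h1 := hlt s hs
      · have hvs := hm.injective h
        rw [hvs, hxS s (by omega)] at hv
        by_cases hsH : s ∈ H
        · exact ⟨s, hsH, by rw [hvs]; exact if_pos hs⟩
        · rw [hcs' s hsH] at hs; exact absurd hs hv
      · have hvs : v = m (x (s + 1)) := by rw [← h, hm.invol]
        rw [hvs, hyS (s + 1) h1] at hv
        by_cases hsH : s + 1 ∈ H
        · exact ⟨s + 1, hsH, by rw [hvs]; exact if_neg hv⟩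
        · rw [hcs' _ hsH] at hv; exact absurd hs hv
    · rw [override_of_not_mem hv hv']
      refine ⟨Or.inl, fun h => h.resolve_right fun h => ?_⟩
      obtain ⟨i, hi, rfl⟩ := Finset.mem_image.1 h
      exact hv' (hPS i hi).2
  · intro v hv w hw
    obtain ⟨i, hi, rfl⟩ := Finset.mem_image.1 hv
    obtain ⟨j, hj, rfl⟩ := Finset.mem_image.1 hw
    rcases lt_trichotomy i j with h | rfl | h
    · exact hPlt i hi j hj h
    · exact G.loopless.irrefl _
    · exact fun h' => hPlt j hj i hi h h'.symm
  · have hSZ : ∀ w ∈ S, w ∈ Z ∧ m w ∈ Z := by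
      rintro w ⟨s, hs, rfl | rfl⟩ <;> have := hlt s hs
      · rw [hm.invol]; exact (hZ s (by omega)).symm
      · exact hZ (s + 1) (by omega)
    refine override_of_not_mem (fun h => hv (hSZ v h).1) fun h => hv ?_
    have := (hSZ _ h).2
    rwa [hm.invol] at this
  · exact Finset.card_image_of_injOn fun i hi j hj h => hPinj i hi j hj h

variable [Fintype V]

/-- A long shortest alternating chain makes it possible to expose a large independent set. -/
theorem IsChain.exists_exposes {r : ℕ} (hr : 2 ≤ r)
    (hc : IsChain m n x (2 * 8 ^ (8 * (r + r)))) (hm : IsMatchingMap G m) (hn : IsClosest G m n)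
    {Z : Finset V} (hZ : ∀ i < 2 * 8 ^ (8 * (r + r)), x i ∈ Z ∧ m (x i) ∈ Z) :
    ∃ f U, Exposes G m Z U f ∧ U.card = r + r := by
  classical
  set p := 8 ^ (8 * (r + r)) with hp
  -- Only even positions are used, so that distinct indices are at least two apart, as the chord
  -- lemmas require. Chords from `m (X i)` forward to `X j` are then impossible, and three Boolean
  -- colours suffice.
  set X : ℕ → V := fun i => x (2 * i) with hX
  let col : ℕ → ℕ → Bool × Bool × Bool := fun i j =>
    (decide (G.Adj (X i) (X j)), decide (G.Adj (m (X i)) (m (X j))),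
      decide (G.Adj (X i) (m (X j))))
  obtain ⟨H, hHp, hHr, ⟨α, γ, δ⟩, hcol⟩ := exists_homogeneous col (r + r) (Finset.range p)
    (by simp [hp]) (by simp)
  have hlt : ∀ i ∈ H, 2 * i < 2 * p := fun i hi => by
    have := Finset.mem_range.1 (hHp hi); omega
  have hα : ∀ i ∈ H, ∀ j ∈ H, i < j → (G.Adj (X i) (X j) ↔ α = true) := fun i hi j hj hij => by
    rw [← (Prod.mk.inj (hcol i hi j hj hij)).1, decide_eq_true_iff]
  have hγ : ∀ i ∈ H, ∀ j ∈ H, i < j → (G.Adj (m (X i)) (m (X j)) ↔ γ = true) :=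
    fun i hi j hj hij => by
      rw [← (Prod.mk.inj (Prod.mk.inj (hcol i hi j hj hij)).2).1, decide_eq_true_iff]
  have hδ : ∀ i ∈ H, ∀ j ∈ H, i < j → (G.Adj (X i) (m (X j)) ↔ δ = true) :=
    fun i hi j hj hij => by
      rw [← (Prod.mk.inj (Prod.mk.inj (hcol i hi j hj hij)).2).2, decide_eq_true_iff]
  have hyx : ∀ i ∈ H, ∀ j ∈ H, i < j → ¬ G.Adj (m (X i)) (X j) := fun i hi j hj hij =>
    hc.not_adj hm hn (by omega) (hlt j hj)
  have hXX : ∀ i ∈ H, ∀ j ∈ H, X i = X j → i = j := fun i hi j hj h => by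
    have := hc.inj _ (hlt i hi) _ (hlt j hj) h; omega
  have hXY : ∀ i ∈ H, ∀ j ∈ H, X i ≠ m (X j) := fun i hi j hj => hc.ne _ (hlt i hi) _ (hlt j hj)
  have hYY : ∀ i ∈ H, ∀ j ∈ H, m (X i) = m (X j) → i = j := fun i hi j hj h =>
    hXX i hi j hj (hm.injective h)
  have hZX : ∀ i ∈ H, X i ∈ Z ∧ m (X i) ∈ Z := fun i hi => hZ _ (hlt i hi)
  obtain ⟨A, hA, B, hB, hAr, hBr, hAB⟩ := exists_split r r H hHr
  have hU : ∀ i ∈ A ∪ B, i ∈ H := fun i hi => (Finset.mem_union.1 hi).elim (@hA i) (@hB i)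
  have hdisj : Disjoint A B := Finset.disjoint_left.2 fun i hi hi' => lt_irrefl _ (hAB i hi i hi')
  have hsymm : ∀ (Q : ℕ → V), (∀ i ∈ H, ∀ j ∈ H, i < j → ¬ G.Adj (Q i) (Q j)) →
      ∀ i ∈ H, ∀ j ∈ H, ¬ G.Adj (Q i) (Q j) := by
    intro Q hQ i hi j hj
    rcases lt_trichotomy i j with h | rfl | h
    · exact hQ i hi j hj h
    · exact G.loopless.irrefl _
    · exact fun h' => hQ j hj i hi h h'.symm
  have hcard : ∀ {f : V → V} {U : Finset V}, Exposes G m Z U f ∧ U.card = A.card + B.card →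
      ∃ f U, Exposes G m Z U f ∧ U.card = r + r := fun {f U} h => ⟨f, U, h.1, by
        rw [h.2, hAr, hBr]⟩
  by_cases h1 : α = true
  · by_cases h2 : γ = true
    -- Three members of `H` carry both chords excluded by `IsChain.not_adj_adj`; `2 ≤ r` provides
    -- them.
    · exfalso
      let e := H.orderEmbOfFin hHr
      have he : ∀ i, e i ∈ H := fun i => Finset.orderEmbOfFin_mem H hHr i
      have h01 : e ⟨0, by omega⟩ < e ⟨1, by omega⟩ := e.strictMono (by simp)
      have h12 : e ⟨1, by omega⟩ < e ⟨2, by omega⟩ := e.strictMono (by simp)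
      exact hc.not_adj_adj hm hn (by omega) (by omega) (hlt _ (he ⟨2, by omega⟩))
        ((hγ _ (he _) _ (he _) h01).2 h2) ((hα _ (he _) _ (he _) h12).2 h1)
    -- The `X i` form a clique and their partners are independent: matching the lower half of the
    -- clique with the upper half exposes the partners.
    · obtain ⟨f, U, h⟩ := exists_exposes_of_complete hm (P := X) (hAr.trans hBr.symm) hdisj
        (fun i hi j hj => hXX i (hU i hi) j (hU j hj))
        (fun i hi j hj => hXY i (hU i hi) j (hU j hj))
        (fun i hi j hj => (hα i (hA hi) j (hB hj) (hAB i hi j hj)).2 h1)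
        (fun i hi j hj => hsymm _ (fun i hi j hj hij => (hγ i hi j hj hij).not.2 h2) i (hU i hi)
          j (hU j hj)) (fun i hi => hZX i (hU i hi))
      exact hcard h
  · have hxx := hsymm X fun i hi j hj hij => (hα i hi j hj hij).not.2 h1
    by_cases h2 : γ = true
    -- The same with the roles of `X i` and `m (X i)` exchanged.
    · obtain ⟨f, U, h⟩ := exists_exposes_of_complete hm (P := fun i => m (X i))
        (hAr.trans hBr.symm) hdisj
        (fun i hi j hj => hYY i (hU i hi) j (hU j hj))
        (fun i hi j hj => by rw [hm.invol]; exact (hXY j (hU j hj) i (hU i hi)).symm)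
        (fun i hi j hj => (hγ i (hA hi) j (hB hj) (hAB i hi j hj)).2 h2)
        (fun i hi j hj => by rw [hm.invol, hm.invol]; exact hxx i (hU i hi) j (hU j hj))
        (fun i hi => by rw [hm.invol]; exact (hZX i (hU i hi)).symm)
      exact hcard h
    have hyy := hsymm (fun i => m (X i)) fun i hi j hj hij => (hγ i hi j hj hij).not.2 h2
    by_cases h3 : δ = true
    -- Each `X i` of the lower half is joined to each `m (X j)` of the upper half. Matching these
    -- exposes `m (X i)` below and `X j` above, between which forward chords are excluded.
    · let P : ℕ → V := fun i => if i ∈ A then X i else m (X i)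
      have hPA : ∀ i ∈ A, P i = X i := fun i hi => if_pos hi
      have hPB : ∀ i ∈ B, P i = m (X i) := fun i hi => if_neg (Finset.disjoint_right.1 hdisj hi)
      have hcases : ∀ i ∈ A ∪ B, i ∈ H ∧ ((i ∈ A ∧ P i = X i) ∨ (i ∈ B ∧ P i = m (X i))) :=
        fun i hi => ⟨hU i hi, (Finset.mem_union.1 hi).imp (fun h => ⟨h, hPA i h⟩)
          fun h => ⟨h, hPB i h⟩⟩
      obtain ⟨f, U, h⟩ := exists_exposes_of_complete (G := G) hm (P := P) (Z := Z)
        (hAr.trans hBr.symm) hdisj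
        (by
          intro i hi j hj h
          obtain ⟨hi, ⟨hi', e⟩ | ⟨hi', e⟩⟩ := hcases i hi <;>
          obtain ⟨hj, ⟨hj', e'⟩ | ⟨hj', e'⟩⟩ := hcases j hj <;> rw [e, e'] at h
          · exact hXX i hi j hj h
          · exact absurd h (hXY i hi j hj)
          · exact absurd h.symm (hXY j hj i hi)
          · exact hYY i hi j hj h)
        (by
          intro i hi j hj h
          obtain ⟨hi, ⟨hi', e⟩ | ⟨hi', e⟩⟩ := hcases i hi <;>
          obtain ⟨hj, ⟨hj', e'⟩ | ⟨hj', e'⟩⟩ := hcases j hj <;> rw [e, e'] at h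
          · exact hXY i hi j hj h
          · rw [hm.invol] at h
            exact absurd (hAB i hi' j hj') (by rw [hXX i hi j hj h]; exact lt_irrefl _)
          · exact absurd (hAB j hj' i hi') (by rw [hYY i hi j hj h]; exact lt_irrefl _)
          · rw [hm.invol] at h
            exact hXY j hj i hi h.symm)
        (by
          intro i hi j hj
          rw [hPA i hi, hPB j hj]
          exact (hδ i (hA hi) j (hB hj) (hAB i hi j hj)).2 h3)
        (by
          intro i hi j hj h
          obtain ⟨hi, ⟨hi', e⟩ | ⟨hi', e⟩⟩ := hcases i hi <;>
          obtain ⟨hj, ⟨hj', e'⟩ | ⟨hj', e'⟩⟩ := hcases j hj <;> rw [e, e'] at h <;>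
          try simp only [hm.invol] at h
          · exact hyy i hi j hj h
          · exact hyx i hi j hj (hAB i hi' j hj') h
          · exact hyx j hj i hi (hAB j hj' i hi') h.symm
          · exact hxx i hi j hj h)
        (by
          intro i hi
          obtain ⟨hi, ⟨hi', e⟩ | ⟨hi', e⟩⟩ := hcases i hi <;> rw [e]
          · exact hZX i hi
          · rw [hm.invol]; exact (hZX i hi).symm)
      exact hcard h
    -- No chord joins vertices at different chosen positions, so shifting along the path exposes an
    -- independent set.
    · have hmemH : ∀ i ∈ H.image (2 * ·), ∃ j ∈ H, 2 * j = i := fun i hi => Finset.mem_image.1 hi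
      have hcardH : (H.image (2 * ·)).card = r + r := by
        rw [Finset.card_image_of_injective _ fun a b h => by simpa using h, hHr]
      obtain ⟨f, U, h, hUc⟩ := hc.exists_exposes_of_shift hm hn.1 (H := H.image (2 * ·)) (Z := Z)
        (by intro i hi; obtain ⟨j, hj, rfl⟩ := hmemH i hi; exact hlt j hj) ⟨r, hcardH⟩
        (by
          intro i hi j hj _
          obtain ⟨i, hi', rfl⟩ := hmemH i hi
          obtain ⟨j, hj', rfl⟩ := hmemH j hj
          exact hxx i hi' j hj')
        (by
          intro i hi j hj _
          obtain ⟨i, hi', rfl⟩ := hmemH i hi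
          obtain ⟨j, hj', rfl⟩ := hmemH j hj
          exact hyy i hi' j hj')
        (by
          intro i hi j hj hij
          obtain ⟨i, hi', rfl⟩ := hmemH i hi
          obtain ⟨j, hj', rfl⟩ := hmemH j hj
          exact (hδ i hi' j hj' (by omega)).not.2 h3)
        (by
          intro i hi j hj hij
          obtain ⟨i, hi', rfl⟩ := hmemH i hi
          obtain ⟨j, hj', rfl⟩ := hmemH j hj
          exact hyx i hi' j hj' (by omega)) hZ
      exact ⟨f, U, h, hUc.trans hcardH⟩

end Expose
-- Every number of uncovered vertices is attained near a given maximal matching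
section Locality

variable {V : Type*} [Fintype V] [DecidableEq V] {G : SimpleGraph V} {m n f : V → V}

/-- If a closest matching `n` differs a lot from `m`, there is a long alternating chain. -/
theorem IsClosest.exists_chain (hn : IsClosest G m n) (hm : IsMatchingMap G m) {ℓ : ℕ}
    (h : ℓ * ((uncovered m).card + (uncovered n).card) < (diffSet m n).card) :
    ∃ x, IsChain m n x ℓ := by
  set p : V → V := fun v => n (m v) with hp
  have hpinj : Function.Injective p := hn.1.injective.comp hm.injective
  -- These are the vertices at which the alternating walk `v ↦ n (m v)` stops.
  set bad : Finset V := Finset.univ.filter fun v => m v = v ∨ n (m v) = m v with hbad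
  have hbadcard : bad.card ≤ (uncovered m).card + (uncovered n).card := by
    have : bad ⊆ uncovered m ∪ (uncovered n).image m := fun v hv => by
      rcases (Finset.mem_filter.1 hv).2 with h | h
      · exact Finset.mem_union_left _ (mem_uncovered.2 h)
      · exact Finset.mem_union_right _
          (Finset.mem_image.2 ⟨m v, mem_uncovered.2 h, hm.invol v⟩)
    exact (Finset.card_le_card this).trans ((Finset.card_union_le _ _).trans
      (Nat.add_le_add_left Finset.card_image_le _))
  -- If every vertex of the difference met `bad` within `ℓ` steps, injectivity of the iterates of
  -- `p` would bound the difference by `ℓ * bad.card`.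
  obtain ⟨z, hz, hgood⟩ : ∃ z, m z ≠ n z ∧ ∀ i < ℓ, p^[i] z ∉ bad := by
    by_contra! hcon
    have hsub : diffSet m n ⊆
        (Finset.range ℓ).biUnion fun i => Finset.univ.filter fun v => p^[i] v ∈ bad := by
      intro v hv
      obtain ⟨i, hi, hb⟩ := hcon v (mem_diffSet.1 hv)
      exact Finset.mem_biUnion.2 ⟨i, Finset.mem_range.2 hi, by simpa using hb⟩
    have h1 := (Finset.card_le_card hsub).trans (Finset.card_biUnion_le_card_mul _ _ bad.card
      fun i _ => Finset.card_le_card_of_injOn (p^[i]) (fun v hv => (Finset.mem_filter.1 hv).2)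
        (hpinj.iterate i).injOn)
    rw [Finset.card_range] at h1
    exact absurd (h1.trans (Nat.mul_le_mul_left ℓ hbadcard)) (not_le.2 h)
  set x : ℕ → V := fun i => p^[i] z with hx
  have hnext : ∀ i, n (m (x i)) = x (i + 1) := fun i => (Function.iterate_succ_apply' p i z).symm
  have hnx : ∀ i, n (x (i + 1)) = m (x i) := fun i => by rw [← hnext, hn.1.invol]
  have hmx : ∀ i < ℓ, m (x i) ≠ x i := fun i hi h => hgood i hi (by simp [hbad]; exact Or.inl h)
  have hnm : ∀ i < ℓ, x (i + 1) ≠ m (x i) := fun i hi h => hgood i hi (by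
    rw [← hnext] at h
    simp [hbad]; exact Or.inr h)
  -- A walk that returns on itself in the opposite direction folds up: `d` drops by two until a
  -- vertex fixed by `m` or by `n` appears, which `hgood` excludes.
  have hstep : ∀ d i, i + d < ℓ → x i ≠ m (x (i + d)) := by
    intro d
    induction d using Nat.strong_induction_on with
    | _ d ih =>
      intro i hi h
      match d, ih, hi, h with
      | 0, _, hi, h => exact hmx i hi h.symm
      | 1, _, hi, h => exact hnm i (by omega) (by rw [h, hm.invol])
      | d + 2, ih, hi, h =>
        refine ih d (by omega) (i + 1) (by omega) ?_
        rw [← hnext i, h, hm.invol, ← hnx (i + 1 + d)]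
        congr 2; omega
  have hne : ∀ i < ℓ, ∀ j < ℓ, x i ≠ m (x j) := by
    intro i hi j hj h
    rcases le_total i j with hij | hij
    · obtain ⟨d, rfl⟩ := Nat.exists_eq_add_of_le hij
      exact hstep d i hj h
    · obtain ⟨d, rfl⟩ := Nat.exists_eq_add_of_le hij
      exact hstep d j hi (by rw [h, hm.invol])
  have hsucc : ∀ i, x i ≠ x (i + 1) := fun i h => by
    have h' : z = p z := hpinj.iterate i (by
      rw [← Function.iterate_succ_apply]; exact h)
    exact hz (by nth_rw 2 [h']; exact (hn.1.invol _).symm)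
  have hper : ∀ i j, i < j → j < ℓ → x i ≠ x j := by
    intro i j hij hj h
    obtain ⟨d, rfl⟩ := Nat.exists_eq_add_of_lt hij
    -- A repetition closes the walk into an alternating cycle at `z`; on it `n` could be replaced by
    -- `m`, contradicting closeness.
    have hzd : x (d + 1) = x 0 := hpinj.iterate i (by
      rw [hx]; simp only; rw [← Function.iterate_add_apply]; exact h.symm)
    set S : Set V := {v | ∃ k < d + 1, v = x k ∨ v = m (x k)} with hS
    have hpred : ∀ k < d + 1, ∃ k' < d + 1, n (x k) = m (x k') ∧ x (k' + 1) = x k := by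
      intro k hk
      cases k with
      | zero => exact ⟨d, by omega, by rw [← hzd, hnx], hzd⟩
      | succ k => exact ⟨k, by omega, hnx k, rfl⟩
    have hsuc : ∀ k < d + 1, ∃ k' < d + 1, n (m (x k)) = x k' := by
      intro k hk
      rcases eq_or_lt_of_le (show k + 1 ≤ d + 1 from hk) with hk' | hk'
      · exact ⟨0, by omega, by rw [hnext, hk', hzd]⟩
      · exact ⟨k + 1, hk', hnext k⟩
    refine hn.no_shortcut hm (S := S) ?_ ?_ ?_ ?_ ?_ (w := x 0) ⟨0, by omega, Or.inl rfl⟩ rfl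
    · rintro v ⟨k, hk, rfl | rfl⟩
      · exact ⟨k, hk, Or.inr rfl⟩
      · exact ⟨k, hk, Or.inl (hm.invol _)⟩
    · rintro v ⟨k, hk, rfl | rfl⟩
      · obtain ⟨k', hk', h1, -⟩ := hpred k hk
        exact ⟨k', hk', Or.inr h1⟩
      · obtain ⟨k', hk', h1⟩ := hsuc k hk
        exact ⟨k', hk', Or.inl h1⟩
    · rintro v ⟨k, hk, rfl | rfl⟩
      · exact hmx k (by omega)
      · rw [hm.invol]; exact (hmx k (by omega)).symm
    · rintro v ⟨k, hk, rfl | rfl⟩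
      · obtain ⟨k', hk', h1, -⟩ := hpred k hk
        rw [h1]; exact (hne _ (by omega) _ (by omega)).symm
      · rw [hnext]; exact hnm k (by omega)
    · rintro v ⟨k, hk, rfl | rfl⟩
      · obtain ⟨k', hk', h1, h2⟩ := hpred k hk
        rw [h1, ← h2]
        exact fun h => hsucc k' (hm.injective h).symm
      · rw [hnext, hm.invol]; exact hsucc k
  refine ⟨x, fun i _ => hnext i, hne, fun i hi j hj h => ?_⟩
  rcases lt_trichotomy i j with hij | hij | hij
  · exact absurd h (hper i j hij hj)
  · exact hij
  · exact absurd h.symm (hper j i hij hi)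

/-- Extending a matching that exposes `U` to a maximal matching covers few vertices of `U`. -/
theorem Exposes.exists_maximal {Z U : Finset V} (h : Exposes G m Z U f) :
    ∃ f', IsMaximalMap G f' ∧ U.card ≤ (uncovered f').card + (uncovered m).card ∧
      (diffSet m f').card ≤ Z.card + (uncovered m).card := by
  obtain ⟨f', hf', hext⟩ := h.isMatching.exists_maximal
  refine ⟨f', hf', ?_, ?_⟩
  -- The new partner of a vertex `v` of `U` is uncovered by `f`, because `f'` keeps the edges of
  -- `f`. It is not in `U` by independence, so `m` leaves it uncovered.
  · have hsub : U ⊆ uncovered f' ∪ (uncovered m).image f' := by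
      intro v hv
      by_cases hfv : f' v = v
      · exact Finset.mem_union_left _ (mem_uncovered.2 hfv)
      refine Finset.mem_union_right _ (Finset.mem_image.2 ⟨f' v, ?_, hf'.invol v⟩)
      have hv' : f v = v := (h.fixed v).2 (Or.inr hv)
      have hff : f (f' v) = f' v := by
        by_contra hcon
        have h1 := hext _ hcon
        rw [hf'.invol] at h1
        have h2 : f v = f' v := by nth_rw 1 [h1]; exact h.isMatching.invol _
        exact hfv (h2.symm.trans hv')
      exact mem_uncovered.2 (((h.fixed _).1 hff).resolve_right fun hU =>
        h.indep v hv _ hU (hf'.adj v hfv))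
    exact (Finset.card_le_card hsub).trans ((Finset.card_union_le _ _).trans
      (Nat.add_le_add_left Finset.card_image_le _))
  · have hsub : diffSet m f' ⊆ Z ∪ uncovered m := by
      intro v hv
      by_cases hZ : v ∈ Z
      · exact Finset.mem_union_left _ hZ
      refine Finset.mem_union_right _ (mem_uncovered.2 ?_)
      by_contra hcon
      rw [← h.agree v hZ] at hcon
      exact mem_diffSet.1 hv (by rw [hext v hcon, h.agree v hZ])
    exact (Finset.card_le_card hsub).trans (Finset.card_union_le _ _)

/-- The radius of the local search, as a function of a bound on the number of uncovered
vertices. -/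
def radius (B : ℕ) : ℕ := 2 ^ (128 * (B + 1))

/-- The chain length needed for Ramsey with `r = B + 2`, times the bound `B + (B + 2)` on the
uncovered vertices of both matchings. In powers of two the exponent is at most `49 * B + 99`; the
constant 128 is generous and is reached by seven doublings. -/
theorem chain_length_le_radius (B : ℕ) :
    2 * 8 ^ (8 * (B + 2 + (B + 2))) * (B + (B + 2)) ≤ radius B := by
  have h1 : B + (B + 2) ≤ 2 ^ (B + 2) := by
    have := Nat.lt_two_pow_self (n := B + 1)
    rw [pow_succ]; omega
  have h2 : 2 * 8 ^ (8 * (B + 2 + (B + 2))) = 2 ^ (48 * B + 97) := by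
    rw [show (8 : ℕ) = 2 ^ 3 by norm_num, ← pow_mul, ← pow_succ']
    congr 1; ring
  rw [h2]
  refine (Nat.mul_le_mul_left _ h1).trans ?_
  rw [← pow_add, radius]
  exact Nat.pow_le_pow_right (by norm_num) (by omega)

/-- If no maximal matching near `m` has more than `B` uncovered vertices, then every maximal
matching with at most `B + 2` uncovered vertices can be brought near `m`. -/
theorem IsMaximalMap.exists_near_of_le {B : ℕ} (hm : IsMaximalMap G m)
    (hB : (uncovered m).card ≤ B)
    (hloc : ∀ f, IsMaximalMap G f → (diffSet m f).card ≤ radius B → (uncovered f).card ≤ B)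
    {N : V → V} (hN : IsMaximalMap G N) (hNB : (uncovered N).card ≤ B + 2) :
    ∃ f, IsMaximalMap G f ∧ (diffSet m f).card ≤ radius B ∧
      (uncovered f).card = (uncovered N).card := by
  obtain ⟨n, ⟨hn, hnN⟩, hmin⟩ := exists_minimalFor_of_wellFoundedLT
    (fun n : V → V => IsMatchingMap G n ∧ uncovered n = uncovered N)
    (fun n => (diffSet m n).card) ⟨N, hN.toIsMatchingMap, rfl⟩
  have hclosest : IsClosest G m n := ⟨hn, fun n' hn' h => by
    by_contra! hlt
    exact absurd (hmin (j := n') ⟨hn', h.trans hnN⟩ hlt.le) (not_le.2 hlt)⟩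
  by_cases hR : (diffSet m n).card ≤ radius B
  · refine ⟨n, ⟨hn, fun v w hv hw => hN.indep v w ?_ ?_⟩, hR, by rw [hnN]⟩
    · rw [← mem_uncovered, ← hnN]; exact mem_uncovered.2 hv
    · rw [← mem_uncovered, ← hnN]; exact mem_uncovered.2 hw
  exfalso
  have hℓ := chain_length_le_radius B
  set ℓ := 2 * 8 ^ (8 * (B + 2 + (B + 2))) with hℓdef
  have hℓpos : 0 < ℓ := by positivity
  obtain ⟨x, hx⟩ := hclosest.exists_chain hm.toIsMatchingMap (ℓ := ℓ) (by
    refine lt_of_le_of_lt ?_ (not_le.1 hR)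
    refine le_trans (Nat.mul_le_mul_left _ ?_) hℓ
    rw [hnN]; omega)
  obtain ⟨f, U, hf, hU⟩ := hx.exists_exposes (r := B + 2) (by omega) hm.toIsMatchingMap hclosest
    (Z := (Finset.range ℓ).image x ∪ (Finset.range ℓ).image fun i => m (x i))
    fun i hi => ⟨Finset.mem_union_left _ (Finset.mem_image_of_mem _ (Finset.mem_range.2 hi)),
      Finset.mem_union_right _ (Finset.mem_image.2 ⟨i, Finset.mem_range.2 hi, rfl⟩)⟩
  obtain ⟨f', hf', h1, h2⟩ := hf.exists_maximal
  have hZ : ((Finset.range ℓ).image x ∪ (Finset.range ℓ).image fun i => m (x i)).card ≤ ℓ + ℓ :=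
    (Finset.card_union_le _ _).trans (Nat.add_le_add (Finset.card_image_le.trans (by simp))
      (Finset.card_image_le.trans (by simp)))
  have h3 := hloc f' hf' (by
    refine le_trans ?_ hℓ
    have : B ≤ ℓ * B := Nat.le_mul_of_pos_left B hℓpos
    rw [mul_add, mul_add]
    omega)
  -- Here `2 * (B + 2)` would be at most the number of uncovered vertices of `f'` plus `B`, hence at
  -- most `2 * B`.
  omega

/-- If no maximal matching near `m` has more than `B` uncovered vertices, then every maximal
matching can be brought near `m` without changing the number of its uncovered vertices. -/
theorem IsMaximalMap.exists_near {B : ℕ} (hm : IsMaximalMap G m) (hB : (uncovered m).card ≤ B)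
    (hloc : ∀ f, IsMaximalMap G f → (diffSet m f).card ≤ radius B → (uncovered f).card ≤ B)
    {N : V → V} (hN : IsMaximalMap G N) :
    ∃ f, IsMaximalMap G f ∧ (diffSet m f).card ≤ radius B ∧
      (uncovered f).card = (uncovered N).card := by
  suffices h : (uncovered N).card ≤ B from hm.exists_near_of_le hB hloc hN (by omega)
  induction hc : (uncovered N).card using Nat.strong_induction_on generalizing N with
  | _ c ih =>
    by_contra! hlt
    by_cases h2 : c ≤ B + 2
    · obtain ⟨f, hf, hfm, hfc⟩ := hm.exists_near_of_le hB hloc hN (by omega)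
      have := hloc f hf hfm
      omega
    -- Augmenting keeps the uncovered set inside that of `N`, hence independent. The result still
    -- has more than `B` uncovered vertices, against the induction hypothesis.
    obtain ⟨n, hn, hsub, hcard, -⟩ := exists_augment hm.toIsMatchingMap hN.toIsMatchingMap
      (by omega)
    have := ih _ (by omega) (N := n) ⟨hn, fun v w hv hw => hN.indep v w
      (mem_uncovered.1 (hsub (mem_uncovered.2 hv)))
      (mem_uncovered.1 (hsub (mem_uncovered.2 hw)))⟩ rfl
    omega

end Locality
/-! ### Matchings as subgraphs and as involutions -/

section Bridge

variable {V : Type*} {G : SimpleGraph V} {f : V → V}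

/-- The subgraph formed by the edges of a matching. -/
def toSubgraph (hf : IsMatchingMap G f) : G.Subgraph where
  verts := {v | f v ≠ v}
  Adj v w := f v = w ∧ v ≠ w
  adj_sub := by rintro v w ⟨rfl, h⟩; exact hf.adj v h.symm
  edge_vert := by rintro v w ⟨rfl, h⟩; exact h.symm
  symm := ⟨by rintro v w ⟨rfl, h⟩; exact ⟨hf.invol v, h.symm⟩⟩

theorem toSubgraph_isMatching (hf : IsMatchingMap G f) : (toSubgraph hf).IsMatching := by
  intro v hv
  exact ⟨f v, ⟨rfl, Ne.symm hv⟩, fun w hw => hw.1.symm⟩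

open Classical in
/-- The partner of a vertex in a matching; an uncovered vertex is its own partner. -/
noncomputable def partner (M : G.Subgraph) (v : V) : V :=
  if h : ∃ w, M.Adj v w then h.choose else v

theorem partner_of_adj {M : G.Subgraph} (hM : M.IsMatching) {v w : V} (h : M.Adj v w) :
    partner M v = w := by
  have hex : ∃ w, M.Adj v w := ⟨w, h⟩
  rw [partner, dif_pos hex]
  exact hM.eq_of_adj_left hex.choose_spec h

theorem partner_of_notMem {M : G.Subgraph} {v : V} (h : v ∉ M.verts) : partner M v = v :=
  dif_neg fun ⟨_, hw⟩ => h (M.edge_vert hw)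

theorem partner_eq_iff {M : G.Subgraph} (hM : M.IsMatching) {v : V} :
    partner M v = v ↔ v ∉ M.verts := by
  refine ⟨fun h hv => ?_, partner_of_notMem⟩
  obtain ⟨w, hw, -⟩ := hM hv
  rw [partner_of_adj hM hw] at h
  exact hw.ne h.symm

theorem isMatchingMap_partner {M : G.Subgraph} (hM : M.IsMatching) :
    IsMatchingMap G (partner M) := by
  have key : ∀ v, partner M v ≠ v → M.Adj v (partner M v) := fun v hv => by
    rw [Ne, partner_eq_iff hM, not_not] at hv
    obtain ⟨w, hw, -⟩ := hM hv
    rwa [partner_of_adj hM hw]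
  refine ⟨fun v => ?_, fun v hv => (key v hv).adj_sub⟩
  by_cases h : partner M v = v
  · rw [h, h]
  · exact partner_of_adj hM (key v h).symm

/-- An edge between two uncovered vertices could be added to `M`. -/
theorem isMaximalMap_partner {M : G.Subgraph} (hM : IsMaximalMatching M) :
    IsMaximalMap G (partner M) := by
  refine ⟨isMatchingMap_partner hM.prop, fun v w hv hw hvw => ?_⟩
  rw [partner_eq_iff hM.prop] at hv hw
  have hdisj : Disjoint M.support (G.subgraphOfAdj hvw).support := by
    rw [hM.prop.support_eq_verts, SimpleGraph.support_subgraphOfAdj, Set.disjoint_left]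
    rintro u hu (rfl | rfl) <;> contradiction
  have := hM.le_of_ge (hM.prop.sup (SimpleGraph.Subgraph.IsMatching.subgraphOfAdj hvw) hdisj)
    le_sup_left
  exact hv (this.1 (Or.inr (by simp)))

theorem isMaximalMatching_toSubgraph (hf : IsMaximalMap G f) :
    IsMaximalMatching (toSubgraph hf.toIsMatchingMap) := by
  refine ⟨toSubgraph_isMatching _, fun M hM hle => ?_⟩
  have key : ∀ v w, M.Adj v w → f v = w := by
    intro v w hvw
    by_cases hv : f v = v
    · by_cases hw : f w = w
      · exact absurd hvw.adj_sub (hf.indep v w hv hw)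
      · have : M.Adj w (f w) := hle.2 ⟨rfl, Ne.symm hw⟩
        rw [hM.eq_of_adj_left hvw.symm this, hf.invol]
    · have : M.Adj v (f v) := hle.2 ⟨rfl, Ne.symm hv⟩
      exact hM.eq_of_adj_left this hvw
  refine ⟨fun v hv => ?_, fun v w hvw => ⟨key v w hvw, hvw.ne⟩⟩
  obtain ⟨w, hw, -⟩ := hM hv
  have := key v w hw
  exact fun h => hw.ne (h.symm.trans this)

variable [Fintype V] [DecidableEq V]

/-- The handshake lemma: covered vertices have degree one in the matching and the others have degree
zero. -/
theorem two_mul_size_add {M : G.Subgraph} (hM : M.IsMatching) :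
    2 * size M + (uncovered (partner M)).card = Fintype.card V := by
  classical
  have h1 := M.spanningCoe.sum_degrees_eq_twice_card_edges
  have h2 : size M = M.spanningCoe.edgeFinset.card := by
    rw [size, ← Set.ncard_coe_finset, SimpleGraph.coe_edgeFinset]
    rfl
  have h3 : ∀ v, M.spanningCoe.degree v = if partner M v = v then 0 else 1 := by
    intro v
    split_ifs with h
    · rw [partner_eq_iff hM] at h
      rw [← SimpleGraph.card_neighborFinset_eq_degree, Finset.card_eq_zero,
        Finset.eq_empty_iff_forall_notMem]
      intro w hw
      rw [SimpleGraph.mem_neighborFinset] at hw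
      exact h (M.edge_vert hw)
    · rw [partner_eq_iff hM, not_not] at h
      obtain ⟨w, hw, huniq⟩ := hM h
      rw [← SimpleGraph.card_neighborFinset_eq_degree, Finset.card_eq_one]
      refine ⟨w, Finset.ext fun u => ?_⟩
      rw [SimpleGraph.mem_neighborFinset, Finset.mem_singleton]
      exact ⟨huniq u, by rintro rfl; exact hw⟩
  simp only [h3] at h1
  rw [h2, ← h1, Finset.sum_ite, Finset.sum_const_zero, zero_add, Finset.sum_const, smul_eq_mul,
    mul_one, add_comm]
  exact Finset.card_filter_add_card_filter_not _

theorem size_toSubgraph (hf : IsMatchingMap G f) :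
    2 * size (toSubgraph hf) + (uncovered f).card = Fintype.card V := by
  rw [← two_mul_size_add (toSubgraph_isMatching hf)]
  congr 2
  ext v
  rw [mem_uncovered, mem_uncovered, partner_eq_iff (toSubgraph_isMatching hf)]
  simp [toSubgraph]

/-- Maximal matchings suffice for `ν`, since extending a matching only removes uncovered vertices.
-/
theorem two_mul_matchingNumber {mn : ℕ} (h₁ : ∃ f, IsMaximalMap G f ∧ (uncovered f).card = mn)
    (h₂ : ∀ f, IsMaximalMap G f → mn ≤ (uncovered f).card) :
    2 * matchingNumber G + mn = Fintype.card V := by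
  obtain ⟨f, hf, rfl⟩ := h₁
  have h : matchingNumber G = size (toSubgraph hf.toIsMatchingMap) := by
    refine IsGreatest.csSup_eq ⟨⟨_, toSubgraph_isMatching _, rfl⟩, ?_⟩
    rintro _ ⟨M, hM, rfl⟩
    obtain ⟨g, hg, hext⟩ := (isMatchingMap_partner hM).exists_maximal
    have h1 := h₂ g hg
    have h2 : (uncovered g).card ≤ (uncovered (partner M)).card :=
      Finset.card_le_card fun v hv => by
        rw [mem_uncovered] at hv ⊢
        by_contra hcon
        exact hcon ((hext v hcon).symm.trans hv)
    have h3 := two_mul_size_add hM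
    have h4 := size_toSubgraph hf.toIsMatchingMap
    omega
  rw [h, size_toSubgraph]

theorem two_mul_mmmNumber {mx : ℕ} (h₁ : ∃ f, IsMaximalMap G f ∧ (uncovered f).card = mx)
    (h₂ : ∀ f, IsMaximalMap G f → (uncovered f).card ≤ mx) :
    2 * mmmNumber G + mx = Fintype.card V := by
  obtain ⟨f, hf, rfl⟩ := h₁
  have h : mmmNumber G = size (toSubgraph hf.toIsMatchingMap) := by
    refine IsLeast.csInf_eq ⟨⟨_, isMaximalMatching_toSubgraph hf, rfl⟩, ?_⟩
    rintro _ ⟨M, hM, rfl⟩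
    have h1 := h₂ _ (isMaximalMap_partner hM)
    have h3 := two_mul_size_add hM.prop
    have h4 := size_toSubgraph hf.toIsMatchingMap
    omega
  rw [h, size_toSubgraph]

theorem card_uncovered_add_two_mul_mmmNumber_le (hf : IsMaximalMap G f) :
    (uncovered f).card + 2 * mmmNumber G ≤ Fintype.card V := by
  have h : mmmNumber G ≤ size (toSubgraph hf.toIsMatchingMap) :=
    Nat.sInf_le ⟨_, isMaximalMatching_toSubgraph hf, rfl⟩
  have := size_toSubgraph hf.toIsMatchingMap
  omega

end Bridge
/-! ### Elementary moves between matchings, and their encoding by numbers -/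

section Moves

variable {V : Type*} [DecidableEq V] {G : SimpleGraph V} {c f : V → V}

/-- Remove the edge at `a`. -/
def unmatch (c : V → V) (a : V) : V → V := Function.update (Function.update c (c a) (c a)) a a

open Classical in
/-- Remove the edges at `a` and at `b`, and add the edge between `a` and `b` if there is one. -/
noncomputable def move (G : SimpleGraph V) (c : V → V) (a b : V) : V → V :=
  if G.Adj a b then
    Function.update (Function.update (unmatch (unmatch c a) b) a b) b a
  else unmatch (unmatch c a) b

theorem unmatch_self (c : V → V) (a : V) : unmatch c a a = a := by simp [unmatch]

theorem unmatch_eq {a v : V} (h : v ≠ c a) : v ≠ a → unmatch c a v = c v := fun h' => by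
  simp [unmatch, h, h']

theorem unmatch_eq_self_or (c : V → V) (a v : V) : unmatch c a v = v ∨ unmatch c a v = c v := by
  by_cases h' : v = a
  · exact Or.inl (by rw [h', unmatch_self])
  by_cases h : v = c a
  · exact Or.inl (by simp [unmatch, h', ← h])
  · exact Or.inr (unmatch_eq h h')

theorem unmatch_of_fixed {a : V} (h : c a = a) : unmatch c a = c := by
  ext v
  by_cases h' : v = a
  · rw [h', unmatch_self, h]
  · exact unmatch_eq (by rwa [h]) h'

theorem IsMatchingMap.unmatch (hc : IsMatchingMap G c) (a : V) :
    IsMatchingMap G (unmatch c a) := by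
  have h : MatchingGapXP.unmatch c a = MatchingGapXP.override c (fun v => v) {a} := by
    ext v
    by_cases h' : v = a
    · subst h'; rw [unmatch_self, override_of_mem (by simp)]
    by_cases h : v = c a
    · rw [override_of_map_mem (by simpa using h') (by simp [h, hc.invol])]
      simp [MatchingGapXP.unmatch, h', ← h]
    · rw [unmatch_eq h h', override_of_not_mem (by simpa using h') fun h'' => h ?_]
      rw [← h'', hc.invol]
  rw [h]
  exact hc.override .id fun v hv => hv

theorem IsMatchingMap.move (hc : IsMatchingMap G c) (a b : V) :
    IsMatchingMap G (move G c a b) := by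
  have hd := (hc.unmatch a).unmatch b
  set d := MatchingGapXP.unmatch (MatchingGapXP.unmatch c a) b with hdef
  have hdb : d b = b := unmatch_self _ b
  have hda : d a = a := by
    rcases unmatch_eq_self_or (MatchingGapXP.unmatch c a) b a with h | h
    · exact h
    · exact h.trans (unmatch_self c a)
  by_cases hab : G.Adj a b
  · have h : MatchingGapXP.move G c a b = MatchingGapXP.override d (Equiv.swap a b) {a, b} := by
      rw [MatchingGapXP.move, if_pos hab, ← hdef]
      ext v
      by_cases hvb : v = b
      · subst hvb; rw [override_of_mem (by simp)]; simp
      by_cases hva : v = a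
      · subst hva; rw [override_of_mem (by simp)]; simp [hvb]
      rw [Function.update_of_ne hvb, Function.update_of_ne hva, override_of_not_mem]
      · simp [hva, hvb]
      · rintro (h | h)
        · exact hva (by rw [← hd.invol v, h, hda])
        · exact hvb (by rw [← hd.invol v, h, hdb])
    rw [h]
    exact hd.override (.swap hab) fun _ => swap_mem_pair
  · rwa [MatchingGapXP.move, if_neg hab]

/-- A move along an edge of `f`, or at an uncovered vertex of `f`, brings a matching nearer to
`f`. -/
theorem move_eq (hc : IsMatchingMap G c) (hf : IsMatchingMap G f) (v : V) {w : V}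
    (hw : c w = f w ∨ w = v) : move G c v (f v) w = f w := by
  have h1 : w ≠ v → w ≠ f v → unmatch c v w = f w := fun h h' => by
    have hcw := hw.resolve_right h
    rw [unmatch_eq (fun h2 => h' ?_) h, hcw]
    rw [← hf.invol w, ← hcw, h2, hc.invol]
  by_cases hv : f v = v
  · rw [hv, move, if_neg (G.loopless.irrefl _), unmatch_of_fixed (unmatch_self c v)]
    by_cases h : w = v
    · rw [h, unmatch_self, hv]
    · exact h1 h (by rwa [hv])
  · rw [move, if_pos (hf.adj v hv)]
    by_cases hwu : w = f v
    · rw [hwu, Function.update_self, hf.invol]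
    rw [Function.update_of_ne hwu]
    by_cases hwv : w = v
    · rw [hwv, Function.update_self]
    rw [Function.update_of_ne hwv, unmatch_eq ?_ hwu, h1 hwv hwu]
    intro h
    rcases unmatch_eq_self_or c v (f v) with h2 | h2
    · exact hwu (h.trans h2)
    · rw [h2] at h
      have hcw := hw.resolve_right hwv
      refine hwv (hf.injective ?_)
      rw [← hcw, h, hc.invol]

theorem move_of_fixed {a b : V} (ha : c a = a) (hb : c b = b) (hab : ¬ G.Adj a b) :
    move G c a b = c := by
  rw [move, if_neg hab, unmatch_of_fixed ha, unmatch_of_fixed hb]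

theorem move_of_fixed_of_adj {a b : V} (ha : c a = a) (hb : c b = b) (hab : G.Adj a b) :
    move G c a b = Function.update (Function.update c a b) b a := by
  rw [move, if_pos hab, unmatch_of_fixed ha, unmatch_of_fixed hb]

end Moves

/-! ### Sequences of moves as digits of a number to the base `n * n` -/

section Codes

variable {n : ℕ} {G : SimpleGraph (Fin n)} {c f : Fin n → Fin n}

theorem div_lt_of_lt_mul_self {z : ℕ} (h : z < n * n) : z / n < n := Nat.div_lt_of_lt_mul h

theorem mod_lt_of_lt_mul_self {z : ℕ} (h : z < n * n) : z % n < n :=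
  Nat.mod_lt _ (Nat.pos_of_ne_zero fun h0 => by subst h0; simp at h)

/-- The move with number `z = a * n + b`. -/
noncomputable def codedMove (G : SimpleGraph (Fin n)) (c : Fin n → Fin n) (z : ℕ) :
    Fin n → Fin n :=
  if h : z < n * n then
    move G c ⟨z / n, div_lt_of_lt_mul_self h⟩ ⟨z % n, mod_lt_of_lt_mul_self h⟩
  else c

/-- The sequence of `L` moves whose numbers are the digits of `q` to the base `n * n`. -/
noncomputable def codedMoves (G : SimpleGraph (Fin n)) : ℕ → ℕ → (Fin n → Fin n) → Fin n → Fin n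
  | 0, _, c => c
  | L + 1, q, c => codedMoves G L (q / (n * n)) (codedMove G c (q % (n * n)))

theorem mul_add_lt_mul_self (a b : Fin n) : a.val * n + b.val < n * n := by
  have ha := a.2
  have hb := b.2
  nlinarith

theorem codedMove_mul_add (a b : Fin n) : codedMove G c (a.val * n + b.val) = move G c a b := by
  have hn : 0 < n := a.pos
  rw [codedMove, dif_pos (mul_add_lt_mul_self a b)]
  congr 1
  · ext
    simp only
    rw [add_comm, Nat.add_mul_div_right _ _ hn, Nat.div_eq_of_lt b.2, zero_add]
  · ext
    simp only
    rw [add_comm, Nat.add_mul_mod_self_right, Nat.mod_eq_of_lt b.2]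

theorem IsMatchingMap.codedMove (hc : IsMatchingMap G c) (z : ℕ) :
    IsMatchingMap G (codedMove G c z) := by
  rw [MatchingGapXP.codedMove]
  split_ifs
  · exact hc.move _ _
  · exact hc

theorem IsMatchingMap.codedMoves (hc : IsMatchingMap G c) (L q : ℕ) :
    IsMatchingMap G (codedMoves G L q c) := by
  induction L generalizing q c with
  | zero => exact hc
  | succ L ih => exact ih (hc.codedMove _) _

/-- Every matching that differs from `c` on at most `L` vertices is reached by `L` moves. -/
theorem exists_codedMoves_eq (hn : 0 < n) (hc : IsMatchingMap G c) (hf : IsMatchingMap G f)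
    {L : ℕ} (h : (diffSet c f).card ≤ L) :
    ∃ t < (n * n) ^ L, codedMoves G L t c = f := by
  induction L generalizing c with
  | zero =>
    refine ⟨0, by simp, ?_⟩
    ext v
    by_contra hv
    have : v ∈ diffSet c f := mem_diffSet.2 fun h => hv (congrArg Fin.val h)
    exact absurd (Finset.card_pos.2 ⟨v, this⟩) (by omega)
  | succ L ih =>
    -- Exactly `L + 1` moves are made. Once `f` has been reached, the vertex `0` serves as a
    -- default, and the move at it changes nothing.
    obtain ⟨v, hv⟩ : ∃ v, (diffSet c f).Nonempty → v ∈ diffSet c f := by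
      by_cases h : (diffSet c f).Nonempty
      · exact ⟨h.choose, fun _ => h.choose_spec⟩
      · exact ⟨⟨0, hn⟩, fun h' => absurd h' h⟩
    have hsub : diffSet (move G c v (f v)) f ⊆ (diffSet c f).erase v := by
      intro w hw
      rw [mem_diffSet] at hw
      rw [Finset.mem_erase, mem_diffSet]
      exact ⟨fun h => hw (move_eq hc hf v (Or.inr h)), fun h => hw (move_eq hc hf v (Or.inl h))⟩
    have hle : (diffSet (move G c v (f v)) f).card ≤ L := by
      refine (Finset.card_le_card hsub).trans ?_
      by_cases hne : (diffSet c f).Nonempty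
      · rw [Finset.card_erase_of_mem (hv hne)]; omega
      · rw [Finset.not_nonempty_iff_eq_empty.1 hne]; simp
    obtain ⟨t, ht, hrun⟩ := ih (hc.move v (f v)) hle
    set z := v.val * n + (f v).val with hz
    have hzN : z < n * n := mul_add_lt_mul_self v (f v)
    refine ⟨z + n * n * t, ?_, ?_⟩
    · rw [pow_succ']
      have : n * n * (t + 1) ≤ n * n * (n * n) ^ L := Nat.mul_le_mul_left _ ht
      rw [mul_add, mul_one] at this
      omega
    · rw [codedMoves, Nat.add_mul_mod_self_left, Nat.mod_eq_of_lt hzN,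
        Nat.add_mul_div_left _ _ (by omega), Nat.div_eq_of_lt hzN, zero_add, hz,
        codedMove_mul_add, hrun]

end Codes

/-! ### Reasoning about programs -/

section Rules

/-- Started in the state `s`, the program `p` halts after at most `T` steps in a state that
satisfies `Q`. -/
def Ends (p : Prog) (s : State) (T : ℕ) (Q : State → Prop) : Prop :=
  ∃ s' t, Run p s s' t ∧ t ≤ T ∧ Q s'

infixr:60 " ;; " => Prog.seq

variable {p q : Prog} {s : State} {T T' a b r v : ℕ} {Q Q' : State → Prop}

@[simp] theorem State.setReg_reg (s : State) (r v x : ℕ) :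
    (s.setReg r v).reg x = if x = r then v else s.reg x := by
  simp [State.setReg, Function.update_apply]

@[simp] theorem State.setReg_mem (s : State) (r v : ℕ) : (s.setReg r v).mem = s.mem := rfl

@[simp] theorem State.setMem_reg (s : State) (a v : ℕ) : (s.setMem a v).reg = s.reg := rfl

@[simp] theorem State.setMem_mem (s : State) (a v : ℕ) :
    (s.setMem a v).mem = Function.update s.mem a v := rfl

theorem Ends.mono (h : Ends p s T Q) (hT : T ≤ T') (hQ : ∀ s', Q s' → Q' s') :
    Ends p s T' Q' := by
  obtain ⟨s', t, hr, ht, hs'⟩ := h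
  exact ⟨s', t, hr, ht.trans hT, hQ s' hs'⟩

theorem Ends.seq (h : Ends p s T fun s' => Ends q s' T' Q) : Ends (p ;; q) s (T + T') Q := by
  obtain ⟨s', t, hr, ht, s'', t', hr', ht', h'⟩ := h
  exact ⟨s'', t + t', hr.seq hr', add_le_add ht ht', h'⟩

theorem Ends.skip (h : Q s) : Ends .skip s 1 Q := ⟨_, _, .skip s, le_rfl, h⟩

theorem Ends.const (h : Q (s.setReg r v)) : Ends (.const r v) s 1 Q :=
  ⟨_, _, .const r v s, le_rfl, h⟩

theorem Ends.copy (h : Q (s.setReg r (s.reg a))) : Ends (.copy r a) s 1 Q :=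
  ⟨_, _, .copy r a s, le_rfl, h⟩

theorem Ends.add (h : Q (s.setReg r (s.reg a + s.reg b))) : Ends (.add r a b) s 1 Q :=
  ⟨_, _, .add r a b s, le_rfl, h⟩

theorem Ends.sub (h : Q (s.setReg r (s.reg a - s.reg b))) : Ends (.sub r a b) s 1 Q :=
  ⟨_, _, .sub r a b s, le_rfl, h⟩

theorem Ends.load (h : Q (s.setReg r (s.mem (s.reg a)))) : Ends (.load r a) s 1 Q :=
  ⟨_, _, .load r a s, le_rfl, h⟩

theorem Ends.store (h : Q (s.setMem (s.reg a) (s.reg b))) : Ends (.store a b) s 1 Q :=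
  ⟨_, _, .store a b s, le_rfl, h⟩

theorem Ends.seq_le {T₁ T₂ : ℕ} {R : State → Prop} (h : Ends p s T₁ R) (hT : T₁ + T₂ ≤ T)
    (h' : ∀ s', R s' → Ends q s' T₂ Q) : Ends (p ;; q) s T Q :=
  (Ends.seq (h.mono le_rfl h')).mono hT fun _ hs => hs

theorem Ends.const_seq (h : Ends q (s.setReg r v) T Q) : Ends (.const r v ;; q) s (T + 1) Q :=
  Ends.seq_le (R := fun s' => s' = s.setReg r v) (.const rfl) (add_comm 1 T).le
    fun _ hs => hs ▸ h

theorem Ends.copy_seq (h : Ends q (s.setReg r (s.reg a)) T Q) :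
    Ends (.copy r a ;; q) s (T + 1) Q :=
  Ends.seq_le (R := fun s' => s' = s.setReg r (s.reg a)) (.copy rfl) (add_comm 1 T).le
    fun _ hs => hs ▸ h

theorem Ends.add_seq (h : Ends q (s.setReg r (s.reg a + s.reg b)) T Q) :
    Ends (.add r a b ;; q) s (T + 1) Q :=
  Ends.seq_le (R := fun s' => s' = s.setReg r (s.reg a + s.reg b)) (.add rfl) (add_comm 1 T).le
    fun _ hs => hs ▸ h

theorem Ends.sub_seq (h : Ends q (s.setReg r (s.reg a - s.reg b)) T Q) :
    Ends (.sub r a b ;; q) s (T + 1) Q :=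
  Ends.seq_le (R := fun s' => s' = s.setReg r (s.reg a - s.reg b)) (.sub rfl) (add_comm 1 T).le
    fun _ hs => hs ▸ h

theorem Ends.load_seq (h : Ends q (s.setReg r (s.mem (s.reg a))) T Q) :
    Ends (.load r a ;; q) s (T + 1) Q :=
  Ends.seq_le (R := fun s' => s' = s.setReg r (s.mem (s.reg a))) (.load rfl) (add_comm 1 T).le
    fun _ hs => hs ▸ h

theorem Ends.store_seq (h : Ends q (s.setMem (s.reg a) (s.reg b)) T Q) :
    Ends (.store a b ;; q) s (T + 1) Q :=
  Ends.seq_le (R := fun s' => s' = s.setMem (s.reg a) (s.reg b)) (.store rfl)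
    (add_comm 1 T).le fun _ hs => hs ▸ h

theorem Ends.cond (h : s.reg a < s.reg b → Ends p s T Q)
    (h' : ¬ s.reg a < s.reg b → Ends q s T' Q) : Ends (.cond a b p q) s (T + T' + 1) Q := by
  by_cases hab : s.reg a < s.reg b
  · obtain ⟨s', t, hr, ht, hs'⟩ := h hab
    exact ⟨s', t + 1, .condTrue hab hr, by omega, hs'⟩
  · obtain ⟨s', t, hr, ht, hs'⟩ := h' hab
    exact ⟨s', t + 1, .condFalse hab hr, by omega, hs'⟩

/-- The rule for loops with an invariant `I` and a measure `μ` that decreases. -/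
theorem Ends.loop (I : State → Prop) (μ : State → ℕ)
    (hstep : ∀ s, I s → s.reg a < s.reg b → Ends p s T fun s' => I s' ∧ μ s' < μ s)
    (hs : I s) :
    Ends (.loop a b p) s ((T + 1) * μ s + 1) fun s' => I s' ∧ ¬ s'.reg a < s'.reg b := by
  induction hμ : μ s using Nat.strong_induction_on generalizing s with
  | _ k ih =>
    by_cases hab : s.reg a < s.reg b
    · obtain ⟨s', t, hr, ht, hs', hlt⟩ := hstep s hs hab
      obtain ⟨s'', t', hr', ht', hs''⟩ := ih _ (hμ ▸ hlt) hs' rfl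
      refine ⟨s'', t + t' + 1, .loopTrue hab hr hr', ?_, hs''⟩
      have h1 : (T + 1) * (μ s' + 1) ≤ (T + 1) * k := Nat.mul_le_mul_left _ (hμ ▸ hlt)
      rw [mul_add, mul_one] at h1
      omega
    · exact ⟨s, 1, .loopFalse hab, by omega, hs, hab⟩

/-- The rule for loops in which register `a` counts from `0` to the value of register `b`. -/
theorem Ends.forLoop (I : ℕ → State → Prop) {k : ℕ}
    (hstep : ∀ j < k, ∀ s, s.reg a = j → s.reg b = k → I j s →
      Ends p s T fun s' => s'.reg a = j + 1 ∧ s'.reg b = k ∧ I (j + 1) s')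
    (ha : s.reg a = 0) (hb : s.reg b = k) (hs : I 0 s) :
    Ends (.loop a b p) s ((T + 1) * k + 1) fun s' => s'.reg b = k ∧ I k s' := by
  have h := Ends.loop (p := p) (s := s) (a := a) (b := b) (T := T)
    (fun s => s.reg b = k ∧ s.reg a ≤ k ∧ I (s.reg a) s) (fun s => k - s.reg a) (by
      rintro s ⟨hb, ha, hI⟩ hlt
      rw [hb] at hlt
      refine (hstep _ hlt s rfl hb hI).mono le_rfl ?_
      rintro s' ⟨ha', hb', hI'⟩
      exact ⟨⟨hb', by omega, ha' ▸ hI'⟩, by omega⟩) ⟨hb, by omega, ha ▸ hs⟩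
  refine h.mono (by rw [ha, Nat.sub_zero]) ?_
  rintro s' ⟨⟨hb', ha', hI⟩, hnot⟩
  obtain hk : s'.reg a = k := by omega
  exact ⟨hb', hk ▸ hI⟩

end Rules

/-! ### Subroutines -/

section Subroutines

/-- Division of register `20` by register `21`, with quotient in `22` and remainder in `23`. -/
def divMod : Prog :=
  .const 22 0 ;; .add 24 20 2 ;; .loop 21 24 (.sub 24 24 21 ;; .add 22 22 2) ;; .sub 23 24 2

/-- Register `24` holds the remaining dividend plus one, so that the strict loop test means "divisor
at most remainder"; the offset is removed at the end. Repeated subtraction makes the time linear in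
the dividend. -/
theorem divMod_spec {s : State} (h2 : s.reg 2 = 1) (hd : 0 < s.reg 21) :
    Ends divMod s (3 * s.reg 20 + 7) fun s' =>
      s'.reg 22 = s.reg 20 / s.reg 21 ∧ s'.reg 23 = s.reg 20 % s.reg 21 ∧
      (∀ r, r < 22 ∨ 24 < r → s'.reg r = s.reg r) ∧ s'.mem = s.mem := by
  refine .const_seq (.add_seq (.seq_le (T₂ := 1) (Ends.loop (T := 2)
    (fun s' => s'.reg 24 + s.reg 21 * s'.reg 22 = s.reg 20 + 1 ∧
      1 ≤ s'.reg 24 ∧ (∀ r, r < 22 ∨ 24 < r → s'.reg r = s.reg r) ∧ s'.mem = s.mem)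
      (fun s' => s'.reg 24) ?_ ?_) ?_ ?_))
  · rintro u ⟨h24, hpos, hr, hm⟩ hlt
    refine .sub_seq (.add ?_)
    simp only [State.setReg_reg, State.setReg_mem, Nat.reduceEqDiff, if_true, if_false,
      hr 21 (by omega), hr 2 (by omega), h2] at hlt ⊢
    refine ⟨⟨?_, by omega, fun r hr' => ?_, hm⟩, by omega⟩
    · rw [mul_add, mul_one]; omega
    · rw [if_neg (by omega), if_neg (by omega), hr r hr']
  · simp only [State.setReg_reg, State.setReg_mem, Nat.reduceEqDiff, if_true, if_false, h2]
    refine ⟨by omega, by omega, fun r hr => ?_, trivial⟩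
    rw [if_neg (by omega), if_neg (by omega)]
  · simp [h2]; omega
  · rintro u ⟨⟨h24, hpos, hr, hm⟩, hlt⟩
    refine .sub ?_
    simp only [State.setReg_reg, State.setReg_mem, Nat.reduceEqDiff, if_true, if_false,
      hr 21 (by omega), hr 2 (by omega), h2] at hlt ⊢
    have hx : s.reg 20 = (u.reg 24 - 1) + s.reg 21 * u.reg 22 := by omega
    refine ⟨?_, ?_, fun r hr' => ?_, hm⟩
    · rw [hx, Nat.add_mul_div_left _ _ hd, Nat.div_eq_of_lt (by omega), zero_add]
    · rw [hx, Nat.add_mul_mod_self_left, Nat.mod_eq_of_lt (by omega)]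
    · rw [if_neg (by omega), hr r hr']

end Subroutines
-- Programs that operate on a matching stored in memory
section Arrays

variable {n β : ℕ} {G : SimpleGraph (Fin n)} {c m : Fin n → Fin n} {s s' : State} {a b : Fin n}

/-- The part of the state that never changes: the order of the graph, the constant one, the
number of pairs of vertices, the address `β` of the current matching, and the adjacency matrix. -/
structure Env (G : SimpleGraph (Fin n)) (β : ℕ) (s : State) : Prop where
  order : s.reg 0 = n
  one : s.reg 2 = 1
  sq : s.reg 3 = n * n
  base : s.reg 4 = β
  le : n * n ≤ β
  adj : ∀ a b : Fin n, G.Adj a b → s.mem (a * n + b) = 1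
  not_adj : ∀ a b : Fin n, ¬ G.Adj a b → s.mem (a * n + b) = 0

/-- The memory holds the map `c` at the address `β`. -/
def Holds (β : ℕ) (c : Fin n → Fin n) (mem : ℕ → ℕ) : Prop := ∀ v : Fin n, mem (β + v) = c v

theorem Env.congr (h : Env G β s) (hr : ∀ r < 5, s'.reg r = s.reg r)
    (hm : ∀ x < n * n, s'.mem x = s.mem x) : Env G β s' where
  order := by rw [hr 0 (by omega), h.order]
  one := by rw [hr 2 (by omega), h.one]
  sq := by rw [hr 3 (by omega), h.sq]
  base := by rw [hr 4 (by omega), h.base]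
  le := h.le
  adj a b hab := by rw [hm _ (mul_add_lt_mul_self a b), h.adj a b hab]
  not_adj a b hab := by rw [hm _ (mul_add_lt_mul_self a b), h.not_adj a b hab]

theorem Holds.update {mem : ℕ → ℕ} (h : Holds β c mem) (a b : Fin n) :
    Holds β (Function.update c a b) (Function.update mem (β + a) b) := by
  intro v
  by_cases hv : v = a
  · subst hv; simp
  · have : β + (v : ℕ) ≠ β + a := fun h => hv (Fin.ext (by omega))
    rw [Function.update_of_ne this, Function.update_of_ne hv, h v]

theorem exists_mul_add_eq {z : ℕ} (h : z < n * n) : ∃ a b : Fin n, z = a * n + b :=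
  ⟨⟨z / n, div_lt_of_lt_mul_self h⟩, ⟨z % n, mod_lt_of_lt_mul_self h⟩,
    (Nat.div_add_mod' z n).symm⟩

theorem mul_add_inj {a b a' b' : Fin n} (h : a.val * n + b = a' * n + b') : a = a' ∧ b = b' := by
  have hn : 0 < n := a.pos
  have h1 := congrArg (· / n) h
  have h2 := congrArg (· % n) h
  simp only [add_comm (_ * n), Nat.add_mul_div_right _ _ hn, Nat.add_mul_mod_self_right,
    Nat.div_eq_of_lt (Fin.is_lt _), Nat.mod_eq_of_lt (Fin.is_lt _), zero_add] at h1 h2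
  exact ⟨Fin.ext h1, Fin.ext h2⟩

/-- Decode the pair of vertices in register `13`. -/
def decodePair : Prog :=
  .copy 20 13 ;; .copy 21 0 ;; divMod ;; .copy 14 22 ;; .copy 15 23 ;; .add 16 4 14 ;; .add 18 4 15

theorem decodePair_spec (he : Env G β s) (hz : s.reg 13 = a * n + b) :
    Ends decodePair s (3 * (n * n) + 13) fun s' =>
      s'.reg 14 = a ∧ s'.reg 15 = b ∧ s'.reg 16 = β + a ∧ s'.reg 18 = β + b ∧
      (∀ r, r < 14 ∨ 24 < r → s'.reg r = s.reg r) ∧ s'.mem = s.mem := by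
  have hn : 0 < n := a.pos
  have hlt := mul_add_lt_mul_self a b
  refine .copy_seq (.copy_seq (.seq_le (T₂ := 4) (divMod_spec ?_ ?_) ?_ ?_))
  · simp [he.one]
  · simpa [he.order] using hn
  · simp [hz]; omega
  · rintro u ⟨h22, h23, hr, hm⟩
    simp only [State.setReg_reg, Nat.reduceEqDiff, if_true, if_false, he.order, hz] at h22 h23
    rw [add_comm, Nat.add_mul_div_right _ _ hn, Nat.div_eq_of_lt b.2, zero_add] at h22
    rw [add_comm, Nat.add_mul_mod_self_right, Nat.mod_eq_of_lt b.2] at h23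
    have h4 := hr 4 (by omega)
    simp only [State.setReg_reg, Nat.reduceEqDiff, if_false, he.base] at h4
    refine .copy_seq (.copy_seq (.add_seq (.add ?_)))
    simp only [State.setReg_reg, Nat.reduceEqDiff, if_true, if_false, h22, h23, h4,
      State.setReg_mem, hm, true_and]
    refine ⟨fun r hr' => ?_, trivial⟩
    rw [if_neg (by omega), if_neg (by omega), if_neg (by omega), if_neg (by omega),
      hr r (by omega)]
    simp only [State.setReg_reg]
    rw [if_neg (by omega), if_neg (by omega)]

/-- Remove the edge at the vertex in register `v`, whose address is in register `p`. -/
def unmatchProg (p v : ℕ) : Prog :=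
  .load 17 p ;; .add 19 4 17 ;; .store 19 17 ;; .store p v

theorem unmatchProg_spec {p v : ℕ} (h4 : s.reg 4 = β) (hc : Holds β c s.mem)
    (hp : s.reg p = β + a) (hv : s.reg v = a) (hp' : p ≠ 17 ∧ p ≠ 19) (hv' : v ≠ 17 ∧ v ≠ 19) :
    Ends (unmatchProg p v) s 4 fun s' => Holds β (unmatch c a) s'.mem ∧
      (∀ r, r ≠ 17 → r ≠ 19 → s'.reg r = s.reg r) ∧
      ∀ x, x < β ∨ β + n ≤ x → s'.mem x = s.mem x := by
  refine .load_seq (.add_seq (.store_seq (.store ?_)))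
  have h1 := hc a
  simp only [State.setReg_reg, State.setReg_mem, State.setMem_mem, State.setMem_reg, h1, h4,
    Nat.reduceEqDiff, if_true, if_false, hp'.1, hp'.2, hv'.1, hv'.2, hp, hv]
  refine ⟨(hc.update (c a) (c a)).update a a, fun r h h' => by simp [h, h'], fun x hx => ?_⟩
  have h1 := a.2
  have h2 := (c a).2
  rw [Function.update_of_ne (by omega), Function.update_of_ne (by omega)]

/-- Perform the move whose number is in register `13`. -/
def moveProg : Prog :=
  decodePair ;; unmatchProg 16 14 ;; unmatchProg 18 15 ;; .load 17 13 ;;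
  .cond 17 2 .skip (.store 16 15 ;; .store 18 14)

/-- The code `a * n + b` in register `13` is also the address of the entry of the adjacency matrix
for `a` and `b`, so adjacency is tested by one load. -/
theorem moveProg_spec (he : Env G β s) (hc : Holds β c s.mem) (hz : s.reg 13 = a * n + b) :
    Ends moveProg s (3 * (n * n) + 30) fun s' => Holds β (move G c a b) s'.mem ∧
      (∀ r, r < 14 ∨ 24 < r → s'.reg r = s.reg r) ∧
      ∀ x, x < β ∨ β + n ≤ x → s'.mem x = s.mem x := by
  refine .seq_le (T₂ := 17) (decodePair_spec he hz) (by omega) ?_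
  rintro u ⟨h14, h15, h16, h18, hr, hm⟩
  have h4 : u.reg 4 = β := by rw [hr 4 (by omega), he.base]
  refine .seq_le (T₂ := 13) (unmatchProg_spec h4 (by rw [hm]; exact hc) h16 h14 (by omega)
    (by omega)) le_rfl ?_
  rintro w ⟨hc', hr', hm'⟩
  refine .seq_le (T₂ := 9) (unmatchProg_spec (β := β) (a := b) (by rw [hr' 4] <;> omega) hc'
    (by rw [hr' 18] <;> omega) (by rw [hr' 15] <;> omega) (by omega) (by omega)) le_rfl ?_
  rintro y ⟨hc'', hr'', hm''⟩
  have hreg : ∀ r, r < 14 ∨ 24 < r → y.reg r = s.reg r := fun r h => by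
    rw [hr'' r (by omega) (by omega), hr' r (by omega) (by omega), hr r h]
  have hmem : ∀ x, x < β ∨ β + n ≤ x → y.mem x = s.mem x := fun x h => by
    rw [hm'' x h, hm' x h, hm]
  have hab := mul_add_lt_mul_self a b
  have hle := he.le
  have hy : ∀ r, r ≠ 17 → r ≠ 19 → y.reg r = u.reg r := fun r h h' => by
    rw [hr'' r h h', hr' r h h']
  refine .load_seq (.mono (T := 1 + 2 + 1) (.cond (fun hlt => .skip ?_) fun hlt =>
    .store_seq (.store ?_)) (by omega) fun _ h => h)
  · simp only [State.setReg_reg, if_true, Nat.reduceEqDiff, if_false, hreg 2 (by omega),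
      hreg 13 (by omega), hz, hmem _ (Or.inl (lt_of_lt_of_le hab hle)), he.one] at hlt
    have hadj : ¬ G.Adj a b := fun h => by rw [he.adj a b h] at hlt; omega
    rw [move, if_neg hadj]
    refine ⟨hc'', fun r h => ?_, hmem⟩
    rw [State.setReg_reg, if_neg (by omega), hreg r h]
  · simp only [State.setReg_reg, if_true, Nat.reduceEqDiff, if_false, hreg 2 (by omega),
      hreg 13 (by omega), hz, hmem _ (Or.inl (lt_of_lt_of_le hab hle)), he.one] at hlt
    have hadj : G.Adj a b := by
      by_contra h
      rw [he.not_adj a b h] at hlt; omega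
    rw [move, if_pos hadj]
    simp only [State.setReg_reg, State.setReg_mem, State.setMem_reg, State.setMem_mem,
      Nat.reduceEqDiff, if_false, hy 14 (by omega) (by omega), hy 15 (by omega) (by omega),
      hy 16 (by omega) (by omega), hy 18 (by omega) (by omega), h14, h15, h16, h18]
    refine ⟨(hc''.update a b).update b a, fun r h => ?_, fun x hx => ?_⟩
    · rw [if_neg (by omega), hreg r h]
    · have h1 := a.2
      have h2 := b.2
      rw [Function.update_of_ne (by omega), Function.update_of_ne (by omega), hmem x hx]

/-- Test whether both vertices of the pair in register `13` are uncovered: if they are, then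
register `25` becomes zero. -/
def testPair : Prog :=
  decodePair ;; .load 17 16 ;; .load 19 18 ;; .sub 25 17 14 ;; .sub 26 14 17 ;; .add 25 25 26 ;;
  .sub 26 19 15 ;; .add 25 25 26 ;; .sub 26 15 19 ;; .add 25 25 26

/-- Truncated differences taken both ways add up to `|c a - a| + |c b - b|`, which vanishes exactly
when both vertices are fixed. -/
theorem testPair_spec (he : Env G β s) (hc : Holds β c s.mem) (hz : s.reg 13 = a * n + b) :
    Ends testPair s (3 * (n * n) + 22) fun s' => (s'.reg 25 = 0 ↔ c a = a ∧ c b = b) ∧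
      (∀ r, r < 14 ∨ 26 < r → s'.reg r = s.reg r) ∧ s'.mem = s.mem := by
  refine .seq_le (T₂ := 9) (decodePair_spec he hz) (by omega) ?_
  rintro u ⟨h14, h15, h16, h18, hr, hm⟩
  refine .load_seq (.load_seq (.sub_seq (.sub_seq (.add_seq (.sub_seq (.add_seq (.sub_seq
    (.add ?_))))))))
  simp only [State.setReg_reg, State.setReg_mem, Nat.reduceEqDiff, if_true, if_false, h14, h15,
    h16, h18, hm, hc a, hc b]
  refine ⟨?_, fun r h => ?_, trivial⟩
  · rw [Fin.ext_iff, Fin.ext_iff]; omega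
  · rw [if_neg (by omega), if_neg (by omega), if_neg (by omega), if_neg (by omega),
      if_neg (by omega), if_neg (by omega), if_neg (by omega), if_neg (by omega),
      if_neg (by omega), hr r (by omega)]

/-- Copy the array at the address in register `3` to the address in register `4`. -/
def copyArray : Prog :=
  .const 13 0 ;;
  .loop 13 0 (.add 14 3 13 ;; .load 15 14 ;; .add 14 4 13 ;; .store 14 15 ;; .add 13 13 2)

theorem copyArray_spec (he : Env G β s) (hm : Holds (n * n) m s.mem) (hβ : n * n + n ≤ β) :
    Ends copyArray s (6 * n + 2) fun s' => Holds β m s'.mem ∧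
      (∀ r < 13, s'.reg r = s.reg r) ∧ ∀ x, x < β ∨ β + n ≤ x → s'.mem x = s.mem x := by
  refine .const_seq (.mono (.forLoop (k := n) (T := 5)
    (fun j s' => (∀ v : Fin n, v.val < j → s'.mem (β + v) = m v) ∧
      (∀ r < 13, s'.reg r = s.reg r) ∧ ∀ x, x < β ∨ β + n ≤ x → s'.mem x = s.mem x)
    ?_ ?_ ?_ ?_) (by omega) ?_)
  · rintro j hj u h13 h0 ⟨h1, h2, h3⟩
    refine .add_seq (.load_seq (.add_seq (.store_seq (.add ?_))))
    have hmj := hm ⟨j, hj⟩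
    simp only at hmj
    simp only [State.setReg_reg, State.setReg_mem, State.setMem_reg, State.setMem_mem,
      Nat.reduceEqDiff, OfNat.zero_ne_ofNat, if_true, if_false, h13, h0, h2 3 (by omega), he.sq,
      h2 4 (by omega), he.base, h2 2 (by omega), he.one,
      h3 (n * n + j) (by omega), hmj, true_and]
    refine ⟨fun v hv => ?_, fun r hr => ?_, fun x hx => ?_⟩
    · by_cases hvj : v.val = j
      · obtain rfl : v = ⟨j, hj⟩ := Fin.ext hvj
        simp
      · rw [Function.update_of_ne (by omega), h1 v (by omega)]
    · rw [if_neg (by omega), if_neg (by omega), if_neg (by omega), if_neg (by omega), h2 r hr]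
    · rw [Function.update_of_ne (by omega), h3 x hx]
  · simp
  · simp [he.order]
  · refine ⟨by simp, fun r hr => ?_, fun x _ => by simp⟩
    rw [State.setReg_reg, if_neg (by omega)]
  · rintro u ⟨-, h1, h2, h3⟩
    exact ⟨fun v => h1 v v.2, h2, h3⟩

/-- Write the empty matching to the address in register `4`. -/
def clearArray : Prog :=
  .const 13 0 ;; .loop 13 0 (.add 14 4 13 ;; .store 14 13 ;; .add 13 13 2)

theorem clearArray_spec (he : Env G β s) :
    Ends clearArray s (4 * n + 2) fun s' => Holds β (fun v : Fin n => v) s'.mem ∧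
      (∀ r < 13, s'.reg r = s.reg r) ∧ ∀ x, x < β ∨ β + n ≤ x → s'.mem x = s.mem x := by
  refine .const_seq (.mono (.forLoop (k := n) (T := 3)
    (fun j s' => (∀ v : Fin n, v.val < j → s'.mem (β + v) = v) ∧
      (∀ r < 13, s'.reg r = s.reg r) ∧ ∀ x, x < β ∨ β + n ≤ x → s'.mem x = s.mem x)
    ?_ ?_ ?_ ?_) (by omega) ?_)
  · rintro j hj u h13 h0 ⟨h1, h2, h3⟩
    refine .add_seq (.store_seq (.add ?_))
    simp only [State.setReg_reg, State.setReg_mem, State.setMem_reg, State.setMem_mem,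
      Nat.reduceEqDiff, OfNat.zero_ne_ofNat, if_true, if_false, h13, h0,
      h2 4 (by omega), he.base, h2 2 (by omega), he.one, true_and]
    refine ⟨fun v hv => ?_, fun r hr => ?_, fun x hx => ?_⟩
    · by_cases hvj : v.val = j
      · rw [hvj, Function.update_self]
      · rw [Function.update_of_ne (by omega), h1 v (by omega)]
    · rw [if_neg (by omega), if_neg (by omega), h2 r hr]
    · rw [Function.update_of_ne (by omega), h3 x hx]
  · simp
  · simp [he.order]
  · refine ⟨by simp, fun r hr => ?_, fun x _ => by simp⟩
    rw [State.setReg_reg, if_neg (by omega)]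
  · rintro u ⟨-, h1, h2, h3⟩
    exact ⟨fun v => h1 v v.2, h2, h3⟩

/-- Count the uncovered vertices of the current matching in register `28`. -/
def countUncovered : Prog :=
  .const 28 0 ;; .const 13 0 ;;
  .loop 13 0 (.add 14 4 13 ;; .load 15 14 ;; .sub 16 15 13 ;; .sub 17 13 15 ;; .add 16 16 17 ;;
    .cond 16 2 (.add 28 28 2) .skip ;; .add 13 13 2)

theorem countUncovered_spec (he : Env G β s) (hc : Holds β c s.mem) :
    Ends countUncovered s (10 * n + 3) fun s' => s'.reg 28 = (uncovered c).card ∧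
      (∀ r < 13, s'.reg r = s.reg r) ∧ s'.mem = s.mem := by
  refine .const_seq (.const_seq (.mono (.forLoop (k := n) (T := 9)
    (fun j s' => s'.reg 28 = ((uncovered c).filter (·.val < j)).card ∧
      (∀ r < 13, s'.reg r = s.reg r) ∧ s'.mem = s.mem)
    ?_ ?_ ?_ ?_) (by omega) ?_))
  · rintro j hj u h13 h0 ⟨h1, h2, h3⟩
    have hcj := hc ⟨j, hj⟩
    simp only at hcj
    have hfilter : (uncovered c).filter (·.val < j + 1) =
        if c ⟨j, hj⟩ = ⟨j, hj⟩ then insert ⟨j, hj⟩ ((uncovered c).filter (·.val < j))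
        else (uncovered c).filter (·.val < j) := by
      ext v
      by_cases hvj : v = ⟨j, hj⟩
      · subst hvj
        split_ifs with h <;> simp [h]
      · have : v.val ≠ j := fun h => hvj (Fin.ext h)
        split_ifs with h <;> simp [hvj] <;> omega
    refine .add_seq (.load_seq (.sub_seq (.sub_seq (.add_seq (.seq_le (T₁ := 3) (T₂ := 1)
      (R := fun s' => s'.reg 28 = ((uncovered c).filter (·.val < j + 1)).card ∧
        s'.reg 13 = j ∧ (∀ r < 13, s'.reg r = s.reg r) ∧ s'.mem = s.mem)
      (.cond (T := 1) (T' := 1) (fun hlt => .add ?_) fun hlt => .skip ?_) le_rfl ?_)))))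
    · simp only [State.setReg_reg, State.setReg_mem, Nat.reduceEqDiff, if_true, if_false, h13, h3,
        h2 4 (by omega), he.base, h2 2 (by omega), he.one, hcj] at hlt ⊢
      refine ⟨?_, trivial, fun r hr => ?_, trivial⟩
      · rw [hfilter, if_pos (Fin.ext (by simp only; omega)),
          Finset.card_insert_of_notMem (by simp), h1]
      · rw [if_neg (by omega), if_neg (by omega), if_neg (by omega), if_neg (by omega),
          if_neg (by omega), if_neg (by omega), h2 r hr]
    · simp only [State.setReg_reg, State.setReg_mem, Nat.reduceEqDiff, if_true, if_false, h13, h3,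
        h2 4 (by omega), he.base, h2 2 (by omega), he.one, hcj] at hlt ⊢
      refine ⟨?_, trivial, fun r hr => ?_, trivial⟩
      · rw [hfilter, if_neg (fun h => ?_), h1]
        have := congrArg Fin.val h
        simp only at this
        omega
      · rw [if_neg (by omega), if_neg (by omega), if_neg (by omega), if_neg (by omega),
          if_neg (by omega), h2 r hr]
    · rintro w ⟨h28, h13', hr, hm⟩
      refine .add ?_
      simp only [State.setReg_reg, State.setReg_mem, Nat.reduceEqDiff, OfNat.zero_ne_ofNat,
        if_true, if_false, h13', hr 2 (by omega), he.one, hr 0 (by omega), he.order, h28, hm,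
        true_and]
      refine ⟨fun r hr' => ?_, trivial⟩
      rw [if_neg (by omega), hr r hr']
  · simp
  · simp [he.order]
  · refine ⟨by simp, fun r hr => ?_, by simp⟩
    rw [State.setReg_reg, if_neg (by omega), State.setReg_reg, if_neg (by omega)]
  · rintro u ⟨-, h1, h2, h3⟩
    refine ⟨?_, h2, h3⟩
    rw [h1, Finset.filter_true_of_mem fun v _ => v.2]

/-- Test whether the uncovered vertices of the current matching are independent: if they are,
then register `29` becomes zero. -/
def testIndependent : Prog :=
  .const 29 0 ;; .const 13 0 ;;
  .loop 13 3 (testPair ;; .load 17 13 ;; .sub 17 2 17 ;; .add 25 25 17 ;;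
    .cond 25 2 (.const 29 1) .skip ;; .add 13 13 2)

/-- Adding one minus the matrix entry to the result of `testPair` gives zero exactly for an edge
with both ends uncovered. The flag in register `29` is raised once and never lowered. -/
theorem testIndependent_spec (he : Env G β s) (hc : Holds β c s.mem) :
    Ends testIndependent s ((3 * (n * n) + 30) * (n * n) + 3) fun s' =>
      (s'.reg 29 = 0 ↔ ∀ v w, c v = v → c w = w → ¬ G.Adj v w) ∧
      (∀ r, r < 13 ∨ r = 28 → s'.reg r = s.reg r) ∧ s'.mem = s.mem := by
  refine .const_seq (.const_seq (.mono (.forLoop (k := n * n) (T := 3 * (n * n) + 29)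
    (fun j s' => (s'.reg 29 = 0 ↔
      ∀ v w : Fin n, v.val * n + w < j → c v = v → c w = w → ¬ G.Adj v w) ∧
      (∀ r, r < 13 ∨ r = 28 → s'.reg r = s.reg r) ∧ s'.mem = s.mem)
    ?_ ?_ ?_ ?_) le_rfl ?_))
  · rintro j hj u h13 h3 ⟨h1, h2, hm⟩
    obtain ⟨a, b, rfl⟩ := exists_mul_add_eq hj
    have hstep : (∀ v w : Fin n, v.val * n + w < a * n + b + 1 → c v = v → c w = w →
        ¬ G.Adj v w) ↔ (∀ v w : Fin n, v.val * n + w < a * n + b → c v = v → c w = w →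
        ¬ G.Adj v w) ∧ ¬ ((c a = a ∧ c b = b) ∧ G.Adj a b) := by
      refine ⟨fun h => ⟨fun v w hvw => h v w (by omega), fun h' =>
        h a b (by omega) h'.1.1 h'.1.2 h'.2⟩, fun h v w hvw hv hw hadj => ?_⟩
      rcases Nat.lt_succ_iff_lt_or_eq.1 hvw with hlt | heq
      · exact h.1 v w hlt hv hw hadj
      · obtain ⟨rfl, rfl⟩ := mul_add_inj heq
        exact h.2 ⟨⟨hv, hw⟩, hadj⟩
    rw [hstep]
    have heu : Env G β u := he.congr (fun r hr => h2 r (by omega)) fun x _ => by rw [hm]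
    refine .seq_le (T₂ := 7) (testPair_spec heu (by rw [hm]; exact hc) h13) le_rfl ?_
    rintro w ⟨h25, hr, hmw⟩
    have hw2 : w.reg 2 = 1 := by rw [hr 2 (by omega), heu.one]
    have hadj : w.mem (a * n + b) = 1 ∧ G.Adj a b ∨ w.mem (a * n + b) = 0 ∧ ¬ G.Adj a b := by
      rw [hmw]
      by_cases h : G.Adj a b
      · exact Or.inl ⟨heu.adj a b h, h⟩
      · exact Or.inr ⟨heu.not_adj a b h, h⟩
    refine .load_seq (.sub_seq (.add_seq (.seq_le (T₁ := 3) (T₂ := 1)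
      (R := fun s' => (s'.reg 29 = 0 ↔ u.reg 29 = 0 ∧ ¬ ((c a = a ∧ c b = b) ∧ G.Adj a b)) ∧
        (∀ r, r < 14 ∨ r = 28 → s'.reg r = u.reg r) ∧ s'.mem = u.mem)
      (.cond (T := 1) (T' := 1) (fun hlt => .const ?_) fun hlt => .skip ?_) le_rfl ?_)))
    · simp only [State.setReg_reg, State.setReg_mem, Nat.reduceEqDiff, if_true, if_false,
        hr 13 (by omega), h13, hw2, hmw] at hlt ⊢
      rw [hmw] at hadj
      refine ⟨iff_of_false (by simp) fun h => h.2 ⟨h25.1 (by omega), ?_⟩, fun r hr' => ?_,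
        trivial⟩
      · exact (hadj.resolve_right fun h => by omega).2
      · rw [if_neg (by omega), if_neg (by omega), if_neg (by omega), if_neg (by omega),
          hr r (by omega)]
    · simp only [State.setReg_reg, State.setReg_mem, Nat.reduceEqDiff, if_true, if_false,
        hr 13 (by omega), h13, hw2, hmw, hr 29 (by omega)] at hlt ⊢
      rw [hmw] at hadj
      refine ⟨iff_self_and.2 fun _ h => ?_, fun r hr' => ?_, trivial⟩
      · have h25' := h25.2 h.1
        have := (hadj.resolve_right fun h' => h'.2 h.2).1
        omega
      · rw [if_neg (by omega), if_neg (by omega), if_neg (by omega), hr r (by omega)]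
    · rintro y ⟨h29, hry, hmy⟩
      refine .add ?_
      simp only [State.setReg_reg, State.setReg_mem, Nat.reduceEqDiff, if_true, if_false,
        hry 13 (by omega), h13, hry 2 (by omega), heu.one, hry 3 (by omega), heu.sq, h29, hmy, hm,
        true_and, h1]
      refine ⟨fun r hr' => ?_, trivial⟩
      rw [if_neg (by omega), hry r (by omega), h2 r hr']
  · simp
  · simp [he.sq]
  · refine ⟨by simp, fun r hr => ?_, by simp⟩
    rw [State.setReg_reg, if_neg (by omega), State.setReg_reg, if_neg (by omega)]
  · rintro u ⟨-, h1, h2, h3⟩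
    refine ⟨h1.trans ⟨fun h v w => h v w (mul_add_lt_mul_self v w), fun h v w _ => h v w⟩, h2, h3⟩

/-- Extend the current matching greedily to a maximal matching. -/
def greedy : Prog :=
  .const 13 0 ;; .loop 13 3 (testPair ;; .cond 25 2 moveProg .skip ;; .add 13 13 2)

theorem greedy_spec (he : Env G β s) (hc : Holds β c s.mem) (hmat : IsMatchingMap G c) :
    Ends greedy s ((6 * (n * n) + 60) * (n * n) + 2) fun s' => (∃ m, IsMaximalMap G m ∧
      Holds β m s'.mem) ∧ (∀ r < 13, s'.reg r = s.reg r) ∧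
      ∀ x, x < β ∨ β + n ≤ x → s'.mem x = s.mem x := by
  refine .const_seq (.mono (.forLoop (k := n * n) (T := 6 * (n * n) + 59)
    (fun j s' => (∃ m, IsMatchingMap G m ∧ (∀ v w : Fin n, v.val * n + w < j → m v = v →
      m w = w → ¬ G.Adj v w) ∧ Holds β m s'.mem) ∧ (∀ r < 13, s'.reg r = s.reg r) ∧
      ∀ x, x < β ∨ β + n ≤ x → s'.mem x = s.mem x)
    ?_ ?_ ?_ ?_) le_rfl ?_)
  · rintro j hj u h13 h3 ⟨⟨m, hm, hind, hmem⟩, hr, hx⟩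
    obtain ⟨a, b, rfl⟩ := exists_mul_add_eq hj
    have hle := he.le
    have heu : Env G β u := he.congr (fun r hr' => hr r (by omega)) fun x h => hx x (by omega)
    refine .seq_le (T₂ := 3 * (n * n) + 33) (testPair_spec heu hmem h13) (by omega) ?_
    rintro w ⟨h25, hrw, hmw⟩
    have hew : Env G β w := heu.congr (fun r hr' => hrw r (by omega)) fun x h => by rw [hmw]
    refine .seq_le (T₁ := 3 * (n * n) + 30 + 1 + 1) (T₂ := 1)
      (R := fun s' => (∃ m, IsMatchingMap G m ∧ (∀ v w : Fin n, v.val * n + w < a * n + b + 1 →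
        m v = v → m w = w → ¬ G.Adj v w) ∧ Holds β m s'.mem) ∧
        (∀ r < 14, s'.reg r = u.reg r) ∧ ∀ x, x < β ∨ β + n ≤ x → s'.mem x = u.mem x)
      (.cond (fun hlt => ?_) fun hlt => .skip ?_) le_rfl ?_
    · rw [hew.one] at hlt
      obtain ⟨ha, hb⟩ := h25.1 (by omega)
      refine (moveProg_spec hew (by rw [hmw]; exact hmem) (by rw [hrw 13 (by omega), h13])).mono
        le_rfl ?_
      rintro y ⟨hy, hry, hmy⟩
      refine ⟨⟨move G m a b, hm.move a b, fun v w' hvw hv hw' => ?_, hy⟩, fun r hr' => ?_,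
        fun x hx' => ?_⟩
      · by_cases hab : G.Adj a b
        -- Adding the edge `a b` only shrinks the uncovered set, so pairs examined earlier cannot
        -- become bad again.
        · have key : ∀ v, move G m a b v = v → m v = v ∧ v ≠ a := by
            intro v hv
            rw [move_of_fixed_of_adj ha hb hab] at hv
            by_cases hvb : v = b
            · subst hvb; rw [Function.update_self] at hv; exact absurd hv hab.ne
            rw [Function.update_of_ne hvb] at hv
            by_cases hva : v = a
            · subst hva; rw [Function.update_self] at hv; exact absurd hv.symm hvb
            rw [Function.update_of_ne hva] at hv
            exact ⟨hv, hva⟩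
          rcases Nat.lt_succ_iff_lt_or_eq.1 hvw with hlt' | heq
          · exact hind v w' hlt' (key v hv).1 (key w' hw').1
          · exact absurd (mul_add_inj heq).1 (key v hv).2
        · rw [move_of_fixed ha hb hab] at hv hw'
          rcases Nat.lt_succ_iff_lt_or_eq.1 hvw with hlt' | heq
          · exact hind v w' hlt' hv hw'
          · obtain ⟨rfl, rfl⟩ := mul_add_inj heq
            exact hab
      · rw [hry r (by omega), hrw r (by omega)]
      · rw [hmy x hx', hmw]
    · rw [hew.one] at hlt
      refine ⟨⟨m, hm, fun v w' hvw hv hw' => ?_, by rwa [hmw]⟩, fun r hr' => ?_,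
        fun x hx' => by rw [hmw]⟩
      · rcases Nat.lt_succ_iff_lt_or_eq.1 hvw with hlt' | heq
        · exact hind v w' hlt' hv hw'
        · obtain ⟨rfl, rfl⟩ := mul_add_inj heq
          have := h25.2 ⟨hv, hw'⟩
          omega
      · rw [hrw r (by omega)]
    · rintro y ⟨hy, hry, hmy⟩
      refine .add ?_
      simp only [State.setReg_reg, State.setReg_mem, Nat.reduceEqDiff, if_true, if_false,
        hry 13 (by omega), h13, hry 2 (by omega), heu.one, hry 3 (by omega), heu.sq, true_and]
      refine ⟨hy, fun r hr' => ?_, fun x hx' => ?_⟩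
      · rw [if_neg (by omega), hry r (by omega), hr r hr']
      · rw [hmy x hx', hx x hx']
  · simp
  · simp [he.sq]
  · refine ⟨⟨c, hmat, by simp, hc⟩, fun r hr => ?_, by simp⟩
    rw [State.setReg_reg, if_neg (by omega)]
  · rintro u ⟨-, ⟨m, h1, h2, h3⟩, h4, h5⟩
    exact ⟨⟨m, ⟨h1, fun v w => h2 v w (mul_add_lt_mul_self v w)⟩, h3⟩, h4, h5⟩

end Arrays
/-! ### The algorithm -/

section Algorithm

variable {n : ℕ} {G : SimpleGraph (Fin n)} {c m : Fin n → Fin n} {s : State}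

/-- Compute `n * n` in register `3`. -/
def setup : Prog :=
  .const 2 1 ;; .const 3 0 ;; .const 5 0 ;; .loop 5 0 (.add 3 3 0 ;; .add 5 5 2) ;; .copy 4 3

theorem setup_spec (x : Instance) :
    Ends setup x.toState (3 * x.n + 5) fun s' =>
      Env x.G (x.n * x.n) s' ∧ s'.reg 1 = x.k := by
  refine .const_seq (.const_seq (.const_seq (.seq_le (T₂ := 1) (Ends.forLoop (k := x.n) (T := 2)
    (fun j s' => s'.reg 3 = j * x.n ∧ s'.reg 1 = x.k ∧ s'.reg 2 = 1 ∧ s'.mem = x.toState.mem)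
    ?_ ?_ ?_ ?_) (by omega) ?_)))
  · rintro j hj u h5 h0 ⟨h3, h1, h2, hm⟩
    refine .add_seq (.add ?_)
    simp [h5, h0, h3, h1, h2, hm]
    ring
  · simp
  · simp [Instance.toState]
  · simp [Instance.toState]
  · rintro u ⟨h0, h3, h1, h2, hm⟩
    refine .copy ⟨⟨by simp [h0], by simp [h2], by simp [h3], by simp [h3], le_rfl,
      fun a b hab => ?_, fun a b hab => ?_⟩, by simp [h1]⟩
    · simp only [State.setReg_mem, hm, Instance.toState]
      exact if_pos ⟨a, b, rfl, hab⟩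
    · simp only [State.setReg_mem, hm, Instance.toState]
      refine if_neg ?_
      rintro ⟨a', b', h, h'⟩
      obtain ⟨rfl, rfl⟩ := mul_add_inj h
      exact hab h'

/-- Compute the radius of the search in register `8`, from the bound in register `6`. -/
def computeRadius : Prog :=
  .const 8 1 ;; .copy 9 6 ;; .add 9 9 9 ;; .add 9 9 9 ;; .add 9 9 9 ;; .add 9 9 9 ;; .add 9 9 9 ;;
  .add 9 9 9 ;; .add 9 9 9 ;; .const 10 0 ;; .loop 10 9 (.add 8 8 8 ;; .add 10 10 2)

/-- Seven doublings give the exponent `128 * s.reg 6`. With `B + 1` in register `6`, the result is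
`radius B`. -/
theorem computeRadius_spec (h2 : s.reg 2 = 1) :
    Ends computeRadius s (384 * s.reg 6 + 11) fun s' => s'.reg 8 = 2 ^ (128 * s.reg 6) ∧
      (∀ r < 8, s'.reg r = s.reg r) ∧ s'.mem = s.mem := by
  refine .const_seq (.copy_seq (.add_seq (.add_seq (.add_seq (.add_seq (.add_seq (.add_seq
    (.add_seq (.const_seq (.mono (.forLoop (k := 128 * s.reg 6) (T := 2)
    (fun j s' => s'.reg 8 = 2 ^ j ∧ (∀ r < 8, s'.reg r = s.reg r) ∧ s'.mem = s.mem)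
    ?_ ?_ ?_ ?_) (by omega) ?_))))))))))
  · rintro j hj u h10 h9 ⟨h8, hr, hm⟩
    refine .add_seq (.add ?_)
    simp only [State.setReg_reg, State.setReg_mem, Nat.reduceEqDiff, if_true, if_false, h10, h9,
      h8, hr 2 (by omega), h2, hm, true_and]
    refine ⟨by rw [pow_succ]; omega, fun r hr' => ?_, trivial⟩
    rw [if_neg (by omega), if_neg (by omega), hr r hr']
  · simp
  · simp only [State.setReg_reg, Nat.reduceEqDiff, if_true, if_false]; omega
  · refine ⟨by simp, fun r hr => ?_, by simp⟩
    simp only [State.setReg_reg]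
    repeat rw [if_neg (by omega)]
  · rintro u ⟨-, h8, hr, hm⟩
    exact ⟨h8, hr, hm⟩

/-- Compute in register `9` the power of register `3` by register `8`. -/
def computePower : Prog :=
  .const 9 1 ;; .const 10 0 ;;
  .loop 10 8 (.const 11 0 ;; .const 12 0 ;; .loop 12 3 (.add 11 11 9 ;; .add 12 12 2) ;;
    .copy 9 11 ;; .add 10 10 2)

theorem computePower_spec (h2 : s.reg 2 = 1) :
    Ends computePower s ((3 * s.reg 3 + 6) * s.reg 8 + 3) fun s' =>
      s'.reg 9 = s.reg 3 ^ s.reg 8 ∧ (∀ r < 9, s'.reg r = s.reg r) ∧ s'.mem = s.mem := by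
  refine .const_seq (.const_seq (.mono (.forLoop (k := s.reg 8) (T := 3 * s.reg 3 + 5)
    (fun j s' => s'.reg 9 = s.reg 3 ^ j ∧ (∀ r < 9, s'.reg r = s.reg r) ∧ s'.mem = s.mem)
    ?_ ?_ ?_ ?_) le_rfl ?_))
  · rintro j hj u h10 h8 ⟨h9, hr, hm⟩
    refine .const_seq (.const_seq (.seq_le (T₂ := 2) (Ends.forLoop (k := s.reg 3) (T := 2)
      (fun i s' => s'.reg 11 = i * s.reg 3 ^ j ∧ s'.reg 10 = j ∧ s'.reg 9 = s.reg 3 ^ j ∧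
        (∀ r < 9, s'.reg r = s.reg r) ∧ s'.mem = s.mem)
      ?_ ?_ ?_ ?_) (by omega) ?_))
    · rintro i hi w h12 h3 ⟨h11, h10, h9, hr, hm⟩
      refine .add_seq (.add ?_)
      simp only [State.setReg_reg, State.setReg_mem, Nat.reduceEqDiff, if_true, if_false, h12, h3,
        h11, h10, h9, hr 2 (by omega), h2, hm, true_and]
      refine ⟨by ring, fun r hr' => ?_, trivial⟩
      rw [if_neg (by omega), if_neg (by omega), hr r hr']
    · simp
    · simp [hr 3 (by omega)]
    · refine ⟨by simp, by simp [h10], by simp [h9], fun r hr' => ?_, by simp [hm]⟩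
      simp only [State.setReg_reg]
      rw [if_neg (by omega), if_neg (by omega), hr r hr']
    · rintro w ⟨-, h11, h10, h9, hr, hm⟩
      refine .copy_seq (.add ?_)
      simp only [State.setReg_reg, State.setReg_mem, Nat.reduceEqDiff, if_true, if_false,
        h11, h10, hr 2 (by omega), h2, hr 8 (by omega), hm, true_and]
      refine ⟨by rw [pow_succ'], fun r hr' => ?_, trivial⟩
      rw [if_neg (by omega), if_neg (by omega), hr r hr']
  · simp
  · simp
  · refine ⟨by simp, fun r hr => ?_, by simp⟩
    simp only [State.setReg_reg]
    rw [if_neg (by omega), if_neg (by omega)]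
  · rintro u ⟨-, h9, hr, hm⟩
    exact ⟨h9, hr, hm⟩

/-- Perform the moves that are encoded by register `11`; their number is in register `8`. -/
def performMoves : Prog :=
  .const 12 0 ;;
  .loop 12 8 (.copy 20 11 ;; .copy 21 3 ;; divMod ;; .copy 11 22 ;; .copy 13 23 ;; moveProg ;;
    .add 12 12 2)

/-- Extracting a digit costs time linear in the code that remains. Quotients do not grow, so the
bound `T` holds throughout. -/
theorem performMoves_spec {β L q T : ℕ} (hn : 0 < n) (he : Env G β s) (hc : Holds β c s.mem)
    (hq : s.reg 11 = q) (hL : s.reg 8 = L) (hqT : q ≤ T) :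
    Ends performMoves s ((3 * T + 3 * (n * n) + 43) * L + 2) fun s' =>
      Holds β (codedMoves G L q c) s'.mem ∧ (∀ r < 11, s'.reg r = s.reg r) ∧
      ∀ x, x < β ∨ β + n ≤ x → s'.mem x = s.mem x := by
  have hN : 0 < n * n := Nat.mul_pos hn hn
  have hle := he.le
  refine .const_seq (.mono (.forLoop (k := L) (T := 3 * T + 3 * (n * n) + 42)
    (fun j s' => (∃ c' q', Holds β c' s'.mem ∧ s'.reg 11 = q' ∧ q' ≤ T ∧
      codedMoves G (L - j) q' c' = codedMoves G L q c) ∧ (∀ r < 11, s'.reg r = s.reg r) ∧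
      ∀ x, x < β ∨ β + n ≤ x → s'.mem x = s.mem x)
    ?_ ?_ ?_ ?_) le_rfl ?_)
  · rintro j hj u h12 h8 ⟨⟨c', q', hc', h11, hq', hcode⟩, hr, hm⟩
    have heu : Env G β u := he.congr (fun r h => hr r (by omega)) fun x h => hm x (by omega)
    refine .copy_seq (.copy_seq (.seq_le (T₁ := 3 * T + 7) (T₂ := 3 * (n * n) + 33)
      ((divMod_spec ?_ ?_).mono ?_ fun _ h => h) (by omega) ?_))
    · simp [heu.one]
    · simp [heu.sq]; omega
    · simp [h11]; omega
    · rintro w ⟨h22, h23, hrw, hmw⟩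
      simp only [State.setReg_reg, Nat.reduceEqDiff, if_true, if_false, heu.sq, h11] at h22 h23
      have hrw' : ∀ r < 20, w.reg r = u.reg r := fun r h => by
        rw [hrw r (by omega)]
        simp only [State.setReg_reg]
        rw [if_neg (by omega), if_neg (by omega)]
      rw [State.setReg_mem, State.setReg_mem] at hmw
      obtain ⟨a, b, hz⟩ := exists_mul_add_eq (Nat.mod_lt q' hN)
      have hew : Env G β ((w.setReg 11 (w.reg 22)).setReg 13 ((w.setReg 11 (w.reg 22)).reg 23)) :=
        heu.congr (fun r h => by
          simp only [State.setReg_reg]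
          rw [if_neg (by omega), if_neg (by omega), hrw' r (by omega)]) fun x h => by
          simp [hmw]
      refine .copy_seq (.copy_seq (.seq_le (T₂ := 1) (moveProg_spec (c := c') (a := a) (b := b)
        hew (by simpa [hmw] using hc') (by simp [h23, hz])) le_rfl ?_))
      rintro y ⟨hy, hry, hmy⟩
      have hry' : ∀ r, r < 11 ∨ r = 12 → y.reg r = u.reg r := fun r h => by
        rw [hry r (by omega)]
        simp only [State.setReg_reg]
        rw [if_neg (by omega), if_neg (by omega), hrw' r (by omega)]
      have hy11 : y.reg 11 = q' / (n * n) := by rw [hry 11 (by omega)]; simp [h22]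
      refine .add ?_
      simp only [State.setReg_reg, State.setReg_mem, Nat.reduceEqDiff, if_true, if_false,
        hry' 12 (by omega), h12, hry' 2 (by omega), heu.one, hry' 8 (by omega), h8, hy11, true_and]
      refine ⟨⟨_, _, hy, rfl, (Nat.div_le_self _ _).trans hq', ?_⟩, fun r hr' => ?_,
        fun x hx => ?_⟩
      · rw [← hcode, show L - j = (L - (j + 1)) + 1 by omega, codedMoves, hz, codedMove_mul_add]
      · rw [if_neg (by omega), hry' r (by omega), hr r hr']
      · rw [hmy x hx, State.setReg_mem, State.setReg_mem, hmw, hm x hx]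
  · simp
  · simp [hL]
  · refine ⟨⟨c, q, by simpa using hc, by simp [hq], hqT, rfl⟩, fun r hr => ?_, by simp⟩
    rw [State.setReg_reg, if_neg (by omega)]
  · rintro u ⟨-, ⟨c', q', hc', -, -, hcode⟩, hr, hm⟩
    rw [Nat.sub_self] at hcode
    exact ⟨hcode ▸ hc', hr, hm⟩

/-- Perform the moves that are encoded by register `10`, starting from the matching at the
address in register `3`. If the result is a maximal matching, then record the number of its
uncovered vertices: one plus the maximum is in register `5`, the minimum in register `7`. -/
def tryCode : Prog :=
  .copy 11 10 ;; copyArray ;; performMoves ;; countUncovered ;; testIndependent ;;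
  .cond 29 2
    (.cond 28 7 (.copy 7 28) .skip ;; .add 28 28 2 ;; .cond 5 28 (.copy 5 28) .skip) .skip

/-- The values recorded after the matching `f` has been seen. -/
structure Recorded (G : SimpleGraph (Fin n)) (f : Fin n → Fin n) (top mn : ℕ) : Prop where
  le : IsMaximalMap G f → (uncovered f).card + 1 ≤ top
  ge : IsMaximalMap G f → mn ≤ (uncovered f).card

/-- The values recorded are those of maximal matchings. -/
structure Attained (G : SimpleGraph (Fin n)) (top mn : ℕ) : Prop where
  top : ∃ f, IsMaximalMap G f ∧ (uncovered f).card + 1 = top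
  mn : ∃ f, IsMaximalMap G f ∧ (uncovered f).card = mn

/-- The working copy lies above address `n * n + n`, so the matrix and the start `m` survive and
every code is tried from the same matching. -/
theorem tryCode_spec {L q T : ℕ} (hn : 0 < n) (he : Env G (n * n + n) s)
    (hm : Holds (n * n) m s.mem) (hmat : IsMatchingMap G m) (hq : s.reg 10 = q)
    (hL : s.reg 8 = L) (hqT : q ≤ T) (hatt : Attained G (s.reg 5) (s.reg 7)) :
    Ends tryCode s ((3 * T + 3 * (n * n) + 43) * L + (3 * (n * n) + 30) * (n * n) + 16 * n + 22)
      fun s' => Recorded G (codedMoves G L q m) (s'.reg 5) (s'.reg 7) ∧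
      Attained G (s'.reg 5) (s'.reg 7) ∧ s.reg 5 ≤ s'.reg 5 ∧ s'.reg 7 ≤ s.reg 7 ∧
      (∀ r < 11, r ≠ 5 → r ≠ 7 → s'.reg r = s.reg r) ∧
      ∀ x < n * n + n, s'.mem x = s.mem x := by
  have he₁ : Env G (n * n + n) (s.setReg 11 (s.reg 10)) :=
    he.congr (fun r h => by rw [State.setReg_reg, if_neg (by omega)]) fun _ _ => rfl
  refine .mono (T := (6 * n + 2) + (((3 * T + 3 * (n * n) + 43) * L + 2) + ((10 * n + 3) +
    (((3 * (n * n) + 30) * (n * n) + 3) + 10))) + 1)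
    (.copy_seq (.seq_le (copyArray_spec he₁ hm le_rfl) le_rfl ?_)) (by omega) fun _ h => h
  rintro s₂ ⟨hc₂, hr₂, hm₂⟩
  have he₂ : Env G (n * n + n) s₂ :=
    he₁.congr (fun r h => hr₂ r (by omega)) fun x h => hm₂ x (by omega)
  have hr₂' : ∀ r < 11, s₂.reg r = s.reg r := fun r h => by
    rw [hr₂ r (by omega), State.setReg_reg, if_neg (by omega)]
  refine .seq_le (performMoves_spec (q := q) (L := L) (T := T) hn he₂ hc₂
    (by rw [hr₂ 11 (by omega)]; simp [hq]) (by rw [hr₂' 8 (by omega), hL]) hqT) le_rfl ?_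
  rintro s₃ ⟨hc₃, hr₃, hm₃⟩
  have he₃ : Env G (n * n + n) s₃ :=
    he₂.congr (fun r h => hr₃ r (by omega)) fun x h => hm₃ x (by omega)
  refine .seq_le (countUncovered_spec he₃ hc₃) le_rfl ?_
  rintro s₄ ⟨h28, hr₄, hm₄⟩
  have he₄ : Env G (n * n + n) s₄ :=
    he₃.congr (fun r h => hr₄ r (by omega)) fun x h => by rw [hm₄]
  refine .seq_le (testIndependent_spec he₄ (by rw [hm₄]; exact hc₃)) le_rfl ?_
  rintro s₅ ⟨h29, hr₅, hm₅⟩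
  have hr' : ∀ r < 11, s₅.reg r = s.reg r := fun r h => by
    rw [hr₅ r (by omega), hr₄ r (by omega), hr₃ r h, hr₂' r h]
  have hmem : ∀ x < n * n + n, s₅.mem x = s.mem x := fun x h => by
    rw [hm₅, hm₄, hm₃ x (by omega), hm₂ x (by omega), State.setReg_mem]
  rw [← hr₅ 28 (by omega)] at h28
  have h2 : s₅.reg 2 = 1 := by rw [hr' 2 (by omega), he.one]
  set f := codedMoves G L q m with hf
  have hfm : IsMatchingMap G f := hmat.codedMoves L q
  have hmax : s₅.reg 29 = 0 ↔ IsMaximalMap G f := h29.trans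
    ⟨fun h => ⟨hfm, h⟩, fun h => h.indep⟩
  refine .mono (T := (3 + 1 + 3) + 1 + 1) (.cond (fun hlt => ?_) fun hlt => .skip ?_) (by omega)
    fun _ h => h
  · have hfmax := hmax.1 (by omega)
    refine .seq_le (T₁ := 3) (T₂ := 4) (R := fun s' => s'.reg 7 = min (s.reg 7) (uncovered f).card ∧
      (∀ r ≠ 7, s'.reg r = s₅.reg r) ∧ s'.mem = s₅.mem)
      (.cond (T := 1) (T' := 1) (fun hlt' => .copy ?_) fun hlt' => .skip ?_) le_rfl ?_
    · rw [h28, hr' 7 (by omega)] at hlt'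
      refine ⟨?_, fun r h => by simp [h], rfl⟩
      rw [State.setReg_reg, if_pos rfl, h28, min_eq_right hlt'.le]
    · rw [h28, hr' 7 (by omega)] at hlt'
      exact ⟨by rw [hr' 7 (by omega), min_eq_left (not_lt.1 hlt')], fun _ _ => rfl, rfl⟩
    rintro s₆ ⟨h7, hr₆, hm₆⟩
    refine .add_seq (.mono (T := 1 + 1 + 1) (Q := fun s' =>
      s'.reg 5 = max (s.reg 5) ((uncovered f).card + 1) ∧ s'.reg 7 = s₆.reg 7 ∧
      (∀ r < 11, r ≠ 5 → s'.reg r = s₆.reg r) ∧ s'.mem = s₅.mem)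
      (.cond (fun hlt' => .copy ?_) fun hlt' => .skip ?_) le_rfl ?_)
    · simp only [State.setReg_reg, State.setReg_mem, Nat.reduceEqDiff, if_true, if_false,
        hr₆ 5 (by omega), hr' 5 (by omega), hr₆ 28 (by omega), h28, hr₆ 2 (by omega), h2,
        hm₆] at hlt' ⊢
      refine ⟨(max_eq_right hlt'.le).symm, trivial, fun r h h' => ?_, trivial⟩
      rw [if_neg h', if_neg (by omega)]
    · simp only [State.setReg_reg, State.setReg_mem, Nat.reduceEqDiff, if_true, if_false,
        hr₆ 5 (by omega), hr' 5 (by omega), hr₆ 28 (by omega), h28, hr₆ 2 (by omega), h2,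
        hm₆] at hlt' ⊢
      refine ⟨(max_eq_left (not_lt.1 hlt')).symm, trivial, fun r h h' => ?_, trivial⟩
      rw [if_neg (by omega)]
    rintro s₇ ⟨h5, h7', hr₇, hm₇⟩
    rw [h7] at h7'
    refine ⟨⟨fun _ => ?_, fun _ => ?_⟩, ⟨?_, ?_⟩, ?_, ?_, fun r h h5' h7'' => ?_, fun x hx => ?_⟩
    · rw [h5]; exact le_max_right _ _
    · rw [h7']; exact min_le_right _ _
    · rw [h5]
      rcases max_choice (s.reg 5) ((uncovered f).card + 1) with h | h <;> rw [h]
      · exact hatt.top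
      · exact ⟨f, hfmax, rfl⟩
    · rw [h7']
      rcases min_choice (s.reg 7) (uncovered f).card with h | h <;> rw [h]
      · exact hatt.mn
      · exact ⟨f, hfmax, rfl⟩
    · rw [h5]; exact le_max_left _ _
    · rw [h7']; exact min_le_left _ _
    · rw [hr₇ r h h5', hr₆ r h7'', hr' r h]
    · rw [hm₇, hmem x hx]
  · have hfmax : ¬ IsMaximalMap G f := fun h => hlt (by rw [hmax.2 h, h2]; exact one_pos)
    rw [hr' 5 (by omega), hr' 7 (by omega)]
    exact ⟨⟨fun h => absurd h hfmax, fun h => absurd h hfmax⟩, hatt, le_rfl, le_rfl,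
      fun r h _ _ => hr' r h, hmem⟩

/-- Try all codes of sequences of moves, with the radius determined by register `5`. -/
def searchRound : Prog :=
  .copy 6 5 ;; computeRadius ;; computePower ;; .const 10 0 ;;
  .loop 10 9 (tryCode ;; .add 10 10 2)

/-- A bound for the time of one round, if `x` is the order of the graph and every maximal matching
leaves at most `C` vertices uncovered. -/
def roundTime {R : Type*} [CommSemiring R] (C : ℕ) (x : R) : R :=
  let L : R := ((2 ^ (128 * (C + 1)) : ℕ) : R)
  let T : R := (x * x + 1) ^ 2 ^ (128 * (C + 1))
  ((3 * T + 3 * (x * x) + 43) * L + (3 * (x * x) + 30) * (x * x) + 16 * x + 24) * T +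
    (3 * (x * x) + 6) * L + (384 * (C + 1 : ℕ) + 17)

/-- The invariant of the search: `B` is the bound that determined the radius of the last round. -/
structure SearchState (G : SimpleGraph (Fin n)) (m : Fin n → Fin n) (k : ℕ) (s : State) :
    Prop where
  env : Env G (n * n + n) s
  holds : Holds (n * n) m s.mem
  target : s.reg 1 = k
  attained : Attained G (s.reg 5) (s.reg 7)
  start : Recorded G m (s.reg 5) (s.reg 7)
  le : s.reg 6 ≤ s.reg 5
  searched : 0 < s.reg 6 → ∀ f, (diffSet m f).card ≤ 2 ^ (128 * s.reg 6) →
    Recorded G f (s.reg 5) (s.reg 7)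

theorem searchRound_spec {C k : ℕ} (hC : ∀ f, IsMaximalMap G f → (uncovered f).card ≤ C)
    (hmat : IsMatchingMap G m) (hs : SearchState G m k s) :
    Ends searchRound s (roundTime C n) fun s' => SearchState G m k s' ∧ s'.reg 6 = s.reg 5 := by
  have htop : s.reg 5 ≤ C + 1 := by
    obtain ⟨f, hf, h⟩ := hs.attained.top
    rw [← h]
    exact Nat.add_le_add_right (hC f hf) 1
  set L := 2 ^ (128 * s.reg 5) with hL
  set L' := 2 ^ (128 * (C + 1)) with hL'
  set T' := (n * n + 1) ^ L' with hT'
  have hLL' : L ≤ L' := Nat.pow_le_pow_right (by norm_num) (by omega)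
  -- The base `n * n + 1` is positive even for `n = 0`, which makes its powers monotone in the
  -- exponent.
  have hTT' : (n * n) ^ L ≤ T' := (Nat.pow_le_pow_left (Nat.le_succ _) _).trans
    (Nat.pow_le_pow_right (Nat.succ_pos _) hLL')
  set t := (3 * T' + 3 * (n * n) + 43) * L' + (3 * (n * n) + 30) * (n * n) + 16 * n + 22 with ht
  have htime : roundTime C n = (384 * (C + 1) + 11) +
      (((3 * (n * n) + 6) * L' + 3) + (((t + 2) * T' + 1) + 1)) + 1 := by
    simp only [roundTime, Nat.cast_id, ← hL', ← hT', ht]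
    ring
  rw [htime]
  refine .copy_seq (.seq_le ((computeRadius_spec ?_).mono (T' := 384 * (C + 1) + 11) ?_
    fun _ h => h) le_rfl ?_)
  · simp [hs.env.one]
  · simp; omega
  rintro s₁ ⟨h8, hr₁, hm₁⟩
  simp only [State.setReg_reg, if_true, State.setReg_mem] at h8 hm₁
  rw [← hL] at h8
  have hr₁' : ∀ r < 8, r ≠ 6 → s₁.reg r = s.reg r := fun r h h' => by
    rw [hr₁ r h, State.setReg_reg, if_neg h']
  have h6 : s₁.reg 6 = s.reg 5 := by rw [hr₁ 6 (by omega)]; simp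
  have h3 : s₁.reg 3 = n * n := by rw [hr₁' 3 (by omega) (by omega), hs.env.sq]
  refine .seq_le ((computePower_spec ?_).mono (T' := (3 * (n * n) + 6) * L' + 3) ?_
    fun _ h => h) le_rfl ?_
  · rw [hr₁' 2 (by omega) (by omega), hs.env.one]
  · rw [h3, h8]; exact Nat.add_le_add_right (Nat.mul_le_mul_left _ hLL') _
  rintro s₂ ⟨h9, hr₂, hm₂⟩
  rw [h3, h8] at h9
  have hr₂' : ∀ r < 8, r ≠ 6 → s₂.reg r = s.reg r := fun r h h' => by
    rw [hr₂ r (by omega), hr₁' r h h']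
  refine .const_seq (.mono (.forLoop (k := (n * n) ^ L) (T := t + 1) (fun j s' =>
    (∀ q < j, Recorded G (codedMoves G L q m) (s'.reg 5) (s'.reg 7)) ∧
    Attained G (s'.reg 5) (s'.reg 7) ∧ s.reg 5 ≤ s'.reg 5 ∧ s'.reg 7 ≤ s.reg 7 ∧
    (∀ r < 10, r ≠ 5 → r ≠ 7 → s'.reg r = s₂.reg r) ∧ ∀ x < n * n + n, s'.mem x = s.mem x)
    ?_ ?_ ?_ ?_) ?_ ?_)
  · rintro j hj u h10 h9u ⟨hrec, hatt, h5, h7, hr, hm⟩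
    have hn : 0 < n := by
      rcases Nat.eq_zero_or_pos n with h0 | h0
      · subst h0
        rw [zero_mul, zero_pow (by positivity)] at hj
        omega
      · exact h0
    have heu : Env G (n * n + n) u := hs.env.congr (fun r h => by
      by_cases h5' : r = 5
      · omega
      · rw [hr r (by omega) h5' (by omega), hr₂' r (by omega) (by omega)]) fun x h => hm x (by omega)
    refine .seq_le (T₁ := t) (T₂ := 1) ((tryCode_spec (T := T') (L := L) (m := m) hn heu
      (fun v => by rw [hm _ (by omega)]; exact hs.holds v) hmat h10
      (by rw [hr 8 (by omega) (by omega) (by omega), hr₂ 8 (by omega), h8]) (by omega)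
      hatt).mono ?_ fun _ h => h) le_rfl ?_
    · rw [ht]
      have := Nat.mul_le_mul_left (3 * T' + 3 * (n * n) + 43) hLL'
      omega
    · rintro w ⟨hrec', hatt', h5', h7', hrw, hmw⟩
      refine .add ?_
      simp only [State.setReg_reg, State.setReg_mem, Nat.reduceEqDiff, if_true, if_false,
        hrw 10 (by omega) (by omega) (by omega), h10, hrw 2 (by omega) (by omega) (by omega),
        heu.one, hrw 9 (by omega) (by omega) (by omega), h9u, true_and]
      refine ⟨fun q hq => ?_, hatt', h5.trans h5', h7'.trans h7, fun r h hr5 hr7 => ?_,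
        fun x hx => by rw [hmw x hx, hm x hx]⟩
      · rcases Nat.lt_succ_iff_lt_or_eq.1 hq with hq | rfl
        · exact ⟨fun h => ((hrec q hq).le h).trans h5', fun h => h7'.trans ((hrec q hq).ge h)⟩
        · exact hrec'
      · rw [if_neg (by omega), hrw r (by omega) hr5 hr7, hr r h hr5 hr7]
  · simp
  · simp [h9]
  · simp only [State.setReg_reg, State.setReg_mem, Nat.reduceEqDiff, if_false,
      hr₂' 5 (by omega) (by omega), hr₂' 7 (by omega) (by omega), hm₂, hm₁]
    refine ⟨by simp, hs.attained, le_rfl, le_rfl, fun r h _ _ => ?_, fun _ _ => trivial⟩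
    rw [if_neg (by omega)]
  · exact Nat.add_le_add_right (Nat.mul_le_mul_left _ hTT') 1
  · rintro u ⟨-, hrec, hatt, h5, h7, hr, hm⟩
    have h6u : u.reg 6 = s.reg 5 := by
      rw [hr 6 (by omega) (by omega) (by omega), hr₂ 6 (by omega), h6]
    have hstart : Recorded G m (u.reg 5) (u.reg 7) :=
      ⟨fun h => (hs.start.le h).trans h5, fun h => h7.trans (hs.start.ge h)⟩
    refine ⟨⟨hs.env.congr (fun r h => ?_) fun x h => hm x (by omega),
      fun v => by rw [hm _ (by omega)]; exact hs.holds v, ?_, hatt, hstart, by rw [h6u]; exact h5,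
      fun _ f hf => ?_⟩, h6u⟩
    · rw [hr r (by omega) (by omega) (by omega), hr₂' r (by omega) (by omega)]
    · rw [hr 1 (by omega) (by omega) (by omega), hr₂' 1 (by omega) (by omega), hs.target]
    · rw [h6u, ← hL] at hf
      -- For `n = 0` there are no codes at all, but `m` is the only map and has been recorded at the
      -- start.
      rcases Nat.eq_zero_or_pos n with h0 | h0
      · subst h0
        rwa [Subsingleton.elim f m]
      refine ⟨fun h => ?_, fun h => ?_⟩ <;>
      · obtain ⟨q, hq, rfl⟩ := exists_codedMoves_eq h0 hmat h.toIsMatchingMap hf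
        first | exact (hrec q hq).le h | exact (hrec q hq).ge h

/-- The algorithm for MatchingGap. -/
def matchingGapProg : Prog :=
  setup ;; clearArray ;; greedy ;; countUncovered ;; .copy 7 28 ;; .add 5 28 2 ;; .const 6 0 ;;
  .add 4 3 0 ;; .loop 6 5 searchRound ;; .add 20 1 1 ;; .add 20 20 7 ;;
  .cond 20 5 (.const 0 1) (.const 0 0)

/-- A bound for the time of the algorithm. -/
def totalTime {R : Type*} [CommSemiring R] (C : ℕ) (x : R) : R :=
  (roundTime C x + 1) * (C + 1 : ℕ) + (6 * (x * x) + 60) * (x * x) + 17 * x + 22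

/-- The time bounds are defined over any commutative semiring so that one expression serves both as
a polynomial and as its value. -/
theorem eval_totalTime (C n : ℕ) :
    (totalTime C (Polynomial.X : Polynomial ℕ)).eval n = totalTime C n := by
  simp only [totalTime, roundTime, Polynomial.eval_add, Polynomial.eval_mul, Polynomial.eval_pow,
    Polynomial.eval_X, Polynomial.eval_ofNat, Polynomial.eval_natCast, Polynomial.eval_one,
    Nat.cast_id]

/-- When the search has ended, the recorded values are correct. -/
theorem SearchState.two_mul_eq {k : ℕ} (hm : IsMaximalMap G m) (hs : SearchState G m k s)
    (hend : ¬ s.reg 6 < s.reg 5) :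
    2 * matchingNumber G + s.reg 7 = n ∧ 2 * mmmNumber G + s.reg 5 = n + 1 ∧
      s.reg 7 < s.reg 5 := by
  have h65 : s.reg 6 = s.reg 5 := le_antisymm hs.le (not_lt.1 hend)
  obtain ⟨f₀, hf₀, htop⟩ := hs.attained.top
  have hsearched : ∀ f, IsMaximalMap G f → (diffSet m f).card ≤ radius (s.reg 5 - 1) →
      (uncovered f).card + 1 ≤ s.reg 5 ∧ s.reg 7 ≤ (uncovered f).card := by
    intro f hf hd
    have := hs.searched (by omega) f (by
      rw [radius, show s.reg 5 - 1 + 1 = s.reg 6 by omega] at hd; exact hd)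
    exact ⟨this.le hf, this.ge hf⟩
  have hall : ∀ f, IsMaximalMap G f →
      (uncovered f).card + 1 ≤ s.reg 5 ∧ s.reg 7 ≤ (uncovered f).card := by
    intro f hf
    -- The last round used the radius for `B = s.reg 5 - 1` and found nothing above `B`, which is
    -- precisely the local hypothesis.
    obtain ⟨f', hf', hd, hcard⟩ := hm.exists_near (B := s.reg 5 - 1)
      (by have := hs.start.le hm; omega)
      (fun f hf hd => by have := (hsearched f hf hd).1; omega) hf
    rw [← hcard]
    exact hsearched f' hf' hd
  have h1 := two_mul_matchingNumber hs.attained.mn fun f hf => (hall f hf).2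
  have h2 := two_mul_mmmNumber ⟨f₀, hf₀, rfl⟩ fun f hf => by have := (hall f hf).1; omega
  rw [Fintype.card_fin] at h1 h2
  have h3 := hall f₀ hf₀
  exact ⟨h1, by omega, by omega⟩

theorem matchingGapProg_spec {C : ℕ} (x : Instance)
    (hC : ∀ f, IsMaximalMap x.G f → (uncovered f).card ≤ C) :
    Ends matchingGapProg x.toState (totalTime C x.n) fun s' =>
      (x.k ≤ matchingGap x.G ∧ s'.reg 0 = 1) ∨ (¬ x.k ≤ matchingGap x.G ∧ s'.reg 0 = 0) := by
  set n := x.n with hn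
  have htime : totalTime C n = (3 * n + 5) + ((4 * n + 2) + (((6 * (n * n) + 60) * (n * n) + 2) +
      ((10 * n + 3) + ((((roundTime C n + 1) * (C + 1) + 1) + 5) + 4)))) := by
    simp only [totalTime, Nat.cast_id]; ring
  rw [htime]
  refine .seq_le (setup_spec x) le_rfl ?_
  rintro s₁ ⟨he₁, hk₁⟩
  refine .seq_le (clearArray_spec he₁) le_rfl ?_
  rintro s₂ ⟨hc₂, hr₂, hm₂⟩
  have he₂ : Env x.G (n * n) s₂ := he₁.congr (fun r h => hr₂ r (by omega)) fun y h => hm₂ y (Or.inl h)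
  refine .seq_le (greedy_spec he₂ hc₂ .id) le_rfl ?_
  rintro s₃ ⟨⟨m, hm, hc₃⟩, hr₃, hm₃⟩
  have he₃ : Env x.G (n * n) s₃ := he₂.congr (fun r h => hr₃ r (by omega)) fun y h => hm₃ y (Or.inl h)
  refine .seq_le (countUncovered_spec he₃ hc₃) le_rfl ?_
  rintro s₄ ⟨h28, hr₄, hm₄⟩
  have he₄ : Env x.G (n * n) s₄ := he₃.congr (fun r h => hr₄ r (by omega)) fun y h => by rw [hm₄]
  refine .copy_seq (.add_seq (.const_seq (.add_seq ?_)))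
  simp only [State.setReg_reg, Nat.reduceEqDiff, OfNat.zero_ne_ofNat, if_false, h28, he₄.one,
    he₄.sq, he₄.order]
  have hstart : SearchState x.G m x.k ((((s₄.setReg 7 (uncovered m).card).setReg 5
      ((uncovered m).card + 1)).setReg 6 0).setReg 4 (n * n + n)) := by
    refine ⟨⟨?_, ?_, ?_, ?_, by omega, he₄.adj, he₄.not_adj⟩, ?_, ?_, ⟨⟨m, hm, ?_⟩, ⟨m, hm, ?_⟩⟩,
      ⟨fun _ => ?_, fun _ => ?_⟩, ?_, ?_⟩ <;>
      simp only [State.setReg_reg, State.setReg_mem, Nat.reduceEqDiff, OfNat.zero_ne_ofNat,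
        OfNat.one_ne_ofNat, if_true, if_false, he₄.order, he₄.one, he₄.sq, le_refl, zero_le,
        lt_irrefl, false_imp_iff]
    · rfl
    · rw [hm₄]; exact hc₃
    · rw [hr₄ 1 (by omega), hr₃ 1 (by omega), hr₂ 1 (by omega), hk₁]
  refine .seq_le (T₁ := (roundTime C n + 1) * (C + 1) + 1) (T₂ := 5)
    -- Each further round raises register `6` to the previous value of register `5`, which is at
    -- most `C + 1`; hence there are at most `C + 1` rounds. Register `6` starts at zero, below the
    -- positive register `5`, so a first round always takes place.
    (((Ends.loop (SearchState x.G m x.k) (fun s => C + 1 - s.reg 6) (fun u hu hlt =>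
      (searchRound_spec hC hm.toIsMatchingMap hu).mono le_rfl ?_) hstart)).mono ?_
      fun _ h => h) le_rfl ?_
  · rintro u' ⟨hu', h6⟩
    obtain ⟨f, hf, htop⟩ := hu.attained.top
    have := hC f hf
    exact ⟨hu', by omega⟩
  · simp [hn]
  rintro u ⟨hu, hend⟩
  obtain ⟨h1, h2, h3⟩ := hu.two_mul_eq hm hend
  -- Twice the gap is `u.reg 5 - 1 - u.reg 7`; the extra one in register `5` turns the comparison
  -- into a strict one.
  have hgap : x.k ≤ matchingGap x.G ↔ x.k + x.k + u.reg 7 < u.reg 5 := by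
    rw [matchingGap]; omega
  refine .add_seq (.add_seq (.mono (T := 1 + 1 + 1) (.cond (fun hlt => .const ?_)
    fun hlt => .const ?_) le_rfl fun _ h => h))
  · simp only [State.setReg_reg, Nat.reduceEqDiff, if_true, if_false, hu.target] at hlt
    exact Or.inl ⟨hgap.2 hlt, by simp⟩
  · simp only [State.setReg_reg, Nat.reduceEqDiff, if_true, if_false, hu.target] at hlt
    exact Or.inr ⟨fun h => hlt (hgap.1 h), by simp⟩

end Algorithm

theorem hasXPAlgorithm : MatchingGap.HasXPAlgorithm halfOrderMinusMMM := by
  -- A maximal matching leaves at most `|V| - 2β = 2c` vertices uncovered; the floor only turns this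
  -- rational into a natural number. The value `c` enters the time bound but not the program.
  refine ⟨matchingGapProg, fun c => ⟨totalTime ⌊2 * c⌋₊ Polynomial.X, fun x hx => ?_⟩⟩
  obtain ⟨s, t, hr, ht, hs⟩ := matchingGapProg_spec (C := ⌊2 * c⌋₊) x fun f hf => by
    refine Nat.le_floor ?_
    have h : (((uncovered f).card + 2 * mmmNumber x.G : ℕ) : ℚ) ≤ (x.n : ℕ) := by
      have := card_uncovered_add_two_mul_mmmNumber_le hf
      rw [Fintype.card_fin] at this
      exact_mod_cast this
    rw [← hx, halfOrderMinusMMM]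
    push_cast at h
    linarith
  exact ⟨s, t, hr, by rw [eval_totalTime]; exact ht, hs⟩

end MatchingGapXP

theorem mainTheorem11 :
    MatchingGapXP.MatchingGap.HasXPAlgorithm MatchingGapXP.halfOrderMinusMMM := by
  exact MatchingGapXP.hasXPAlgorithm
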